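/- Let $n\ge 1$, let $B\subseteq\mathbb R$ be open, and let $\beta\mapsto\Gamma(\beta)$ be a twice differentiable map from $B$ to the symmetric positive definite $n\times n$ real matrices. Let $Y$ be an $n\times k$ random matrix ($k\ge 1$), jointly Gaussian with $E(Y_{ir})=0$ and $\operatorname{cov}(Y_{ir},Y_{js})=\Gamma(\beta)_{ij}\Sigma_{rs}$, where $\Sigma$ belongs to one of the following sets of $k\times k$ matrices: $\{\sigma^2 I_k:\sigma>0\}$ (Model I); $\{\operatorname{diag}(\sigma_1^2,\dots,\sigma_k^2):\sigma_r>0\}$ (Model II); all symmetric positive definite matrices (Model III). Write $$l(\Gamma,\Sigma;Y)=-\tfrac12\log\det(\Gamma\otimes\Sigma)-\tfrac12\operatorname{tr}(Y'\Gamma^{-1}Y\Sigma^{-1}),\qquad l_p(\Gamma;Y)=\sup_{\Sigma}l(\Gamma,\Sigma;Y)\in[-\infty,+\infty],$$ the supremum being over all $\Sigma$ in the model, and $l_p(\beta)=l_p(\Gamma(\beta);Y)$. Put $W=\Gamma(\beta)^{-1}$, $D=d\Gamma/d\beta$ and $V=n\operatorname{tr}(WDWD)-\operatorname{tr}^2(WD)$.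 For every $\beta\in B$ and every $\Sigma$ in the model, in the cases listed below $l_p$ is almost surely finite and twice differentiable on $B$, $\partial l_p/\partial\beta$ is square integrable, $\partial^2 l_p/\partial\beta^2$ is integrable, and $$\operatorname{var}\Big(\frac{\partial l_p}{\partial\beta}\Big)=-E\Big(\frac{\partial^2 l_p}{\partial\beta^2}\Big)=\begin{cases}V\,\dfrac{k^2}{2(nk+2)}&\text{(Model I, all }k\ge1),\\[2mm] V\,\dfrac{k}{2(n+2)}&\text{(Model II, all }k\ge1),\\[2mm] V\,\dfrac{k(n-k)}{2(n-1)(n+2)}&\text{(Model III, }n\ge2,\ 1\le k\le n).\end{cases}$$ Consequently, for Model III let $FI_k=\operatorname{var}(\partial l_p/\partial\beta)$ with $k$ series ($1\le k\le n$; it does not depend on $\Sigma$). If $|k-n/2|\le|k'-n/2|$ then $FI_{k'}\le FI_k$, and if $V\ne0$ and $|k-n/2|<|k'-n/2|$ then $FI_{k'}<FI_k$; that is, the Fisher information peaks at $k=n/2$ (for odd $n$, at the two integers nearest to $n/2$). For $k=n$, also when $n=1$, $\operatorname{var}(\partial l_p/\partial\beta)=-E(\partial^2l_p/\partial\beta^2)=0$.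 Finally, for Model III with $k\ge n$ the likelihood is constant in $\Gamma$: (a) for every $n\times k$ matrix $Y$, the value $l_p(\Gamma;Y)\in[-\infty,+\infty]$ is the same for all positive definite $\Gamma$; (b) almost surely, the marginal log likelihood $\tfrac k2\log\det\Gamma^{-1}-\tfrac{\max(k,n)}2\log\operatorname{Det}(Y'\Gamma^{-1}Y)$, where $\operatorname{Det}$ is the product of the non-zero eigenvalues, is the same for all positive definite $\Gamma$; (c) there is a single orbit of the action $Y\mapsto Yg$, $g\in GL_k(\mathbb R)$, that has probability one for all positive definite $\Gamma,\Sigma$, so that the maximal invariant, whose likelihood is the one in (b), is almost surely constant. -/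

import Mathlib

open MeasureTheory ProbabilityTheory Matrix
open scoped Kronecker

noncomputable section

namespace SeparableGaussian

/-- Matrices carry the product (Borel) σ-algebra. -/
instance instMeasurableSpaceMatrix (n k : ℕ) : MeasurableSpace (Matrix (Fin n) (Fin k) ℝ) :=
  inferInstanceAs (MeasurableSpace (Fin n → Fin k → ℝ))

/-- The law of a random `n × k` matrix `Y`, jointly Gaussian with mean zero and
`cov (Y i r) (Y j s) = Γ i j * S r s`. -/
def law {n k : ℕ} (Γ : Matrix (Fin n) (Fin n) ℝ) (S : Matrix (Fin k) (Fin k) ℝ) :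
    Measure (Matrix (Fin n) (Fin k) ℝ) :=
  (multivariateGaussian (0 : EuclideanSpace ℝ (Fin n × Fin k)) (Γ ⊗ₖ S)).map
    (fun x => Matrix.of fun i r => x (i, r))

/-- The map in `law` is measurable, so `law Γ S` is a genuine probability measure. -/
theorem measurable_toMatrix (n k : ℕ) :
    Measurable (fun x : EuclideanSpace ℝ (Fin n × Fin k) =>
      (Matrix.of fun i r => x (i, r) : Matrix (Fin n) (Fin k) ℝ)) := by
  refine measurable_pi_iff.2 fun i => measurable_pi_iff.2 fun r => ?_
  change Measurable fun x : EuclideanSpace ℝ (Fin n × Fin k) => x (i, r)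
  fun_prop

instance isProbabilityMeasure_law {n k : ℕ} (Γ : Matrix (Fin n) (Fin n) ℝ)
    (S : Matrix (Fin k) (Fin k) ℝ) : IsProbabilityMeasure (law Γ S) :=
  Measure.isProbabilityMeasure_map (measurable_toMatrix n k).aemeasurable

/-- Model I: `S = σ² I`. -/
def modelI (k : ℕ) : Set (Matrix (Fin k) (Fin k) ℝ) :=
  {S | ∃ σ : ℝ, 0 < σ ∧ S = σ ^ 2 • (1 : Matrix (Fin k) (Fin k) ℝ)}

/-- Model II: `S = diag (σ₁², …, σ_k²)`. -/
def modelII (k : ℕ) : Set (Matrix (Fin k) (Fin k) ℝ) :=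
  {S | ∃ σ : Fin k → ℝ, (∀ r, 0 < σ r) ∧ S = Matrix.diagonal fun r => σ r ^ 2}

/-- Model III: `S` is an arbitrary symmetric positive definite matrix. -/
def modelIII (k : ℕ) : Set (Matrix (Fin k) (Fin k) ℝ) :=
  {S | S.PosDef}

/-- The Gaussian log likelihood, without the constant `-(n k / 2) log (2 π)`. -/
def logLik {n k : ℕ} (Γ : Matrix (Fin n) (Fin n) ℝ) (S : Matrix (Fin k) (Fin k) ℝ)
    (Y : Matrix (Fin n) (Fin k) ℝ) : ℝ :=
  -(1 / 2) * Real.log (Γ ⊗ₖ S).det - (1 / 2) * (Yᵀ * Γ⁻¹ * Y * S⁻¹).trace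

/-- The profile log likelihood of `Γ`: the supremum of the log likelihood over all `S` in the
model `M`. It takes values in the extended reals, as the supremum may be infinite. -/
def profileLogLik {n k : ℕ} (M : Set (Matrix (Fin k) (Fin k) ℝ))
    (Γ : Matrix (Fin n) (Fin n) ℝ) (Y : Matrix (Fin n) (Fin k) ℝ) : EReal :=
  ⨆ S ∈ M, (logLik Γ S Y : EReal)

/-- The real-valued profile log likelihood along a curve `b ↦ Γ b`. -/
def profileCurve {n k : ℕ} (M : Set (Matrix (Fin k) (Fin k) ℝ))
    (Γ : ℝ → Matrix (Fin n) (Fin n) ℝ) (Y : Matrix (Fin n) (Fin k) ℝ) (b : ℝ) : ℝ :=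
  (profileLogLik M (Γ b) Y).toReal

/-- The profile score `∂ l_p / ∂ β`. -/
def score {n k : ℕ} (M : Set (Matrix (Fin k) (Fin k) ℝ))
    (Γ : ℝ → Matrix (Fin n) (Fin n) ℝ) (β : ℝ) (Y : Matrix (Fin n) (Fin k) ℝ) : ℝ :=
  deriv (profileCurve M Γ Y) β

/-- The second derivative `∂² l_p / ∂ β²`. -/
def secondDeriv {n k : ℕ} (M : Set (Matrix (Fin k) (Fin k) ℝ))
    (Γ : ℝ → Matrix (Fin n) (Fin n) ℝ) (β : ℝ) (Y : Matrix (Fin n) (Fin k) ℝ) : ℝ :=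
  deriv (deriv (profileCurve M Γ Y)) β

/-- The Fisher information for `β` in the profile log likelihood: the variance of the score when
`Y` has covariance `Γ β ⊗ S`. -/
def fisherInfo {n k : ℕ} (M : Set (Matrix (Fin k) (Fin k) ℝ))
    (Γ : ℝ → Matrix (Fin n) (Fin n) ℝ) (β : ℝ) (S : Matrix (Fin k) (Fin k) ℝ) : ℝ :=
  variance (score M Γ β) (law (Γ β) S)

/-- The second Bartlett identity at `β` with common value `v`: when `Y` has covariance
`Γ β ⊗ S`, the profile log likelihood is almost surely finite and twice differentiable on the
parameter space `B`, the score is square integrable, the second derivative is integrable, and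
`var (∂ l_p / ∂ β) = - E (∂² l_p / ∂ β²) = v`. -/
structure BartlettTwo {n k : ℕ} (M : Set (Matrix (Fin k) (Fin k) ℝ)) (B : Set ℝ)
    (Γ : ℝ → Matrix (Fin n) (Fin n) ℝ) (β : ℝ) (S : Matrix (Fin k) (Fin k) ℝ) (v : ℝ) :
    Prop where
  finite : ∀ᵐ Y ∂(law (Γ β) S), ∀ b ∈ B,
    profileLogLik M (Γ b) Y ≠ ⊤ ∧ profileLogLik M (Γ b) Y ≠ ⊥
  differentiable : ∀ᵐ Y ∂(law (Γ β) S), DifferentiableOn ℝ (profileCurve M Γ Y) B ∧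
    DifferentiableOn ℝ (deriv (profileCurve M Γ Y)) B
  memLp_score : MemLp (score M Γ β) 2 (law (Γ β) S)
  integrable_secondDeriv : Integrable (secondDeriv M Γ β) (law (Γ β) S)
  fisherInfo_eq : fisherInfo M Γ β S = v
  neg_integral_eq : -∫ Y, secondDeriv M Γ β Y ∂(law (Γ β) S) = v

/-- The entrywise derivative `D = dΓ/dβ`. -/
def derivMatrix {n : ℕ} (Γ : ℝ → Matrix (Fin n) (Fin n) ℝ) (β : ℝ) :
    Matrix (Fin n) (Fin n) ℝ :=
  Matrix.of fun i j => deriv (fun b => Γ b i j) β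

/-- `V = n tr (W D W D) - (tr (W D))²` with `W = Γ⁻¹`. -/
def V {n : ℕ} (Γ : ℝ → Matrix (Fin n) (Fin n) ℝ) (β : ℝ) : ℝ :=
  n * ((Γ β)⁻¹ * derivMatrix Γ β * (Γ β)⁻¹ * derivMatrix Γ β).trace
    - ((Γ β)⁻¹ * derivMatrix Γ β).trace ^ 2

/-- The product of the non-zero eigenvalues, with multiplicity, of a symmetric matrix. -/
def pseudoDet {k : ℕ} (A : Matrix (Fin k) (Fin k) ℝ) : ℝ :=
  (A.charpoly.roots.filter fun x => x ≠ 0).prod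

/-- The marginal log likelihood of `Γ` based on the maximal invariant under the action
`Y ↦ Y g` of `GL_k`, for arbitrary `n` and `k`:
`(k/2) log det W - (max k n / 2) log Det (Y' W Y)` with `W = Γ⁻¹`. -/
def marginalLogLik {n k : ℕ} (Γ : Matrix (Fin n) (Fin n) ℝ) (Y : Matrix (Fin n) (Fin k) ℝ) : ℝ :=
  k / 2 * Real.log (Γ⁻¹).det - (max k n : ℕ) / 2 * Real.log (pseudoDet (Yᵀ * Γ⁻¹ * Y))

end SeparableGaussian

end

/-!
The three profile log likelihoods are, up to constants, sums of terms of one form,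
`concentrated X G = -(κ/2) log det G - (N/2) log det (Xᵀ G⁻¹ X)` with `X` an `N × κ` block of the data:
for Model III the block is `Y` itself, for Model II there is one block for each column of `Y`, and for
Model I the single block is the vector of all entries of `Y`, with `G = Γ ⊗ 1` in the place of `Γ`
(`profileLogLik_modelIII_eq`, `profileLogLik_modelII_eq`, `profileLogLik_modelI_eq`).

Choose `K` with `G(β)⁻¹ = Kᵀ K` and put `A = K G' Kᵀ`. In these coordinates the score and the second
derivative depend on the block only through the orthogonal projection `P` onto the column space of
`K X`: the score is `(N/2) tr (P A) - (κ/2) tr A`, and the second derivative is linear in `P` apart from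
the term `(N/2) tr (P A P A)` (`concentratedScore_eq`, `concentratedHess_eq`). A Gaussian law is
preserved by the linear maps that fix its covariance matrix, so the law of `P` is invariant under
`P ↦ O P Oᵀ` for orthogonal `O`. Hence the tensors `E P` and `E (P ⊗ P)` are isotropic (`tensor_two_eq`,
`tensor_four_eq`), and their constants follow from `tr P = κ` and `P² = P`. The identities
`tr (E P) A = (κ/N) tr A` and those for `E (tr P A)²` and `E tr (P A P A)` give mean zero for the score
and the common value `(N tr A² - (tr A)²) κ (N - κ) / (2 (N - 1) (N + 2))` for its variance and for the
negative mean of the second derivative. For Model II a rotation of one column that fixes the others shows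
that the scores of different columns are uncorrelated (`bartlettTwo_of_concentrated`).

For Model III this value is proportional to `k (n - k) = n²/4 - (k - n/2)²`, with the factor `V ≥ 0`.
When `k ≥ n`, the likelihood is unbounded if the columns of `Y` are dependent, and otherwise `k = n` and
`log det (Yᵀ G⁻¹ Y)` splits into `-log det G` and a term free of `G`. The marginal likelihood is treated
through `charpoly (Yᵀ W Y)` and `charpoly (W Y Yᵀ)`, which differ by a power of the variable, and almost
every `Y` lies in the orbit of the partial identity matrix, since square minors vanish with probability
zero (`ae_det_submatrix_ne_zero`).
-/

namespace SeparableGaussian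

/-! ### Entrywise derivatives of matrix-valued curves -/

/-- The matrix-valued curve `M` has the entrywise derivative `M'` at `b`. No norm on matrices is
involved. -/
def HasEntryDerivAt {ι κ : Type*} (M : ℝ → Matrix ι κ ℝ) (M' : Matrix ι κ ℝ) (b : ℝ) : Prop :=
  ∀ i j, HasDerivAt (fun x => M x i j) (M' i j) b

section EntryDeriv

variable {ι κ ν : Type*} [Fintype κ]

theorem hasEntryDerivAt_const (A : Matrix ι ν ℝ) (b : ℝ) :
    HasEntryDerivAt (fun _ => A) 0 b :=
  fun i j => hasDerivAt_const b (A i j)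

theorem HasEntryDerivAt.mul {M : ℝ → Matrix ι κ ℝ} {N : ℝ → Matrix κ ν ℝ} {M' : Matrix ι κ ℝ}
    {N' : Matrix κ ν ℝ} {b : ℝ} (hM : HasEntryDerivAt M M' b) (hN : HasEntryDerivAt N N' b) :
    HasEntryDerivAt (fun x => M x * N x) (M' * N b + M b * N') b := by
  intro i j
  simp only [Matrix.mul_apply, Matrix.add_apply, ← Finset.sum_add_distrib]
  exact HasDerivAt.fun_sum fun l _ => (hM i l).mul (hN l j)

theorem HasEntryDerivAt.neg {M : ℝ → Matrix ι ν ℝ} {M' : Matrix ι ν ℝ} {b : ℝ}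
    (hM : HasEntryDerivAt M M' b) : HasEntryDerivAt (fun x => -M x) (-M') b :=
  fun i j => (hM i j).neg

theorem HasEntryDerivAt.congr_of_eventuallyEq {M N : ℝ → Matrix ι ν ℝ} {M' : Matrix ι ν ℝ}
    {b : ℝ} (hM : HasEntryDerivAt M M' b) (h : N =ᶠ[nhds b] M) : HasEntryDerivAt N M' b :=
  fun i j => (hM i j).congr_of_eventuallyEq (h.mono fun x hx => by simp only [hx])

theorem HasEntryDerivAt.unique {M : ℝ → Matrix ι ν ℝ} {M₁ M₂ : Matrix ι ν ℝ} {b : ℝ}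
    (h₁ : HasEntryDerivAt M M₁ b) (h₂ : HasEntryDerivAt M M₂ b) : M₁ = M₂ :=
  Matrix.ext fun i j => (h₁ i j).unique (h₂ i j)

theorem HasEntryDerivAt.const_mul_mul_const {μ : Type*} [Fintype ν] {M : ℝ → Matrix κ ν ℝ}
    {M' : Matrix κ ν ℝ} {b : ℝ} (hM : HasEntryDerivAt M M' b) (A : Matrix ι κ ℝ)
    (C : Matrix ν μ ℝ) : HasEntryDerivAt (fun x => A * M x * C) (A * M' * C) b := by
  simpa using ((hasEntryDerivAt_const A b).mul hM).mul (hasEntryDerivAt_const C b)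

theorem HasEntryDerivAt.trace {M : ℝ → Matrix κ κ ℝ} {M' : Matrix κ κ ℝ} {b : ℝ}
    (hM : HasEntryDerivAt M M' b) : HasDerivAt (fun x => (M x).trace) M'.trace b := by
  simp only [Matrix.trace, Matrix.diag_apply]
  exact HasDerivAt.fun_sum fun i _ => hM i i

variable [DecidableEq κ]

/-- Jacobi's formula. -/
theorem HasEntryDerivAt.det {M : ℝ → Matrix κ κ ℝ} {M' : Matrix κ κ ℝ} {b : ℝ}
    (hM : HasEntryDerivAt M M' b) :
    HasDerivAt (fun x => (M x).det) (((M b).adjugate * M').trace) b := by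
  have key : ((M b).adjugate * M').trace
      = ∑ σ : Equiv.Perm κ, (Equiv.Perm.sign σ : ℝ) *
        ∑ i, (∏ j ∈ Finset.univ.erase i, M b (σ j) j) * M' (σ i) i := by
    have h1 : ((M b).adjugate * M').trace
        = ∑ i, ((M b).updateCol i (fun l => M' l i)).det := by
      simp only [Matrix.trace, Matrix.diag_apply]
      refine Finset.sum_congr rfl fun i _ => ?_
      rw [← Matrix.cramer_apply, Matrix.cramer_eq_adjugate_mulVec]
      rfl
    rw [h1]
    simp only [Matrix.det_apply', Finset.mul_sum]
    rw [Finset.sum_comm]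
    refine Finset.sum_congr rfl fun σ _ => Finset.sum_congr rfl fun i _ => ?_
    rw [← Finset.prod_erase_mul _ _ (Finset.mem_univ i)]
    congr 2
    · refine Finset.prod_congr rfl fun j hj => ?_
      rw [Matrix.updateCol_ne (Finset.ne_of_mem_erase hj)]
    · rw [Matrix.updateCol_self]
  rw [key]
  simp only [Matrix.det_apply']
  refine HasDerivAt.fun_sum fun σ _ => HasDerivAt.const_mul _ ?_
  have := HasDerivAt.fun_finsetProd (u := Finset.univ) (f := fun j x => M x (σ j) j)
    (f' := fun j => M' (σ j) j) (x := b) (fun j _ => hM (σ j) j)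
  simpa [smul_eq_mul] using this

theorem HasEntryDerivAt.log_det {M : ℝ → Matrix κ κ ℝ} {M' : Matrix κ κ ℝ} {b : ℝ}
    (hM : HasEntryDerivAt M M' b) (h : (M b).det ≠ 0) :
    HasDerivAt (fun x => Real.log (M x).det) (((M b)⁻¹ * M').trace) b := by
  convert hM.det.log h using 1
  rw [Matrix.inv_def, Ring.inverse_eq_inv', Matrix.smul_mul, Matrix.trace_smul, smul_eq_mul,
    div_eq_inv_mul]

theorem HasEntryDerivAt.eventually_det_ne_zero {M : ℝ → Matrix κ κ ℝ} {M' : Matrix κ κ ℝ} {b : ℝ}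
    (hM : HasEntryDerivAt M M' b) (h : (M b).det ≠ 0) : ∀ᶠ x in nhds b, (M x).det ≠ 0 :=
  hM.det.continuousAt.eventually_ne h

theorem HasEntryDerivAt.inv {M : ℝ → Matrix κ κ ℝ} {M' : Matrix κ κ ℝ} {b : ℝ}
    (hM : HasEntryDerivAt M M' b) (h : (M b).det ≠ 0) :
    HasEntryDerivAt (fun x => (M x)⁻¹) (-((M b)⁻¹ * M' * (M b)⁻¹)) b := by
  obtain ⟨N, hN⟩ : ∃ N, HasEntryDerivAt (fun x => (M x)⁻¹) N b := by
    have : ∀ i j, DifferentiableAt ℝ (fun x => (M x)⁻¹ i j) b := by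
      intro i j
      have hadj : DifferentiableAt ℝ (fun x => (M x).adjugate i j) b := by
        simp only [Matrix.adjugate_apply]
        have : HasEntryDerivAt (fun x => (M x).updateRow j (Pi.single i 1)) (M'.updateRow j 0) b := by
          intro p q
          by_cases hp : p = j
          · subst hp
            simpa using hasDerivAt_const b _
          · simpa [Matrix.updateRow_ne hp] using hM p q
        exact this.det.differentiableAt
      simp only [Matrix.inv_def, Ring.inverse_eq_inv', Matrix.smul_apply, smul_eq_mul]
      exact (hM.det.differentiableAt.inv h).mul hadj
    exact ⟨Matrix.of fun i j => deriv (fun x => (M x)⁻¹ i j) b, fun i j => (this i j).hasDerivAt⟩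
  have h1 : M' * (M b)⁻¹ + M b * N = 0 := by
    refine (hM.mul hN).unique ((hasEntryDerivAt_const 1 b).congr_of_eventuallyEq ?_)
    filter_upwards [hM.eventually_det_ne_zero h] with x hx
    exact Matrix.mul_nonsing_inv _ (isUnit_iff_ne_zero.2 hx)
  have h2 : N = -((M b)⁻¹ * M' * (M b)⁻¹) := by
    have h3 : (M b)⁻¹ * (M b * N) = -((M b)⁻¹ * M' * (M b)⁻¹) := by
      rw [eq_neg_of_add_eq_zero_right h1, Matrix.mul_neg, Matrix.mul_assoc]
    rwa [Matrix.nonsing_inv_mul_cancel_left _ _ (isUnit_iff_ne_zero.2 h)] at h3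
  rwa [← h2]

/-- The second derivative of `log det M`. -/
theorem HasEntryDerivAt.trace_inv_mul {M M₁ : ℝ → Matrix κ κ ℝ} {M₂ : Matrix κ κ ℝ} {b : ℝ}
    (hM : HasEntryDerivAt M (M₁ b) b) (hM₁ : HasEntryDerivAt M₁ M₂ b) (h : (M b).det ≠ 0) :
    HasDerivAt (fun x => ((M x)⁻¹ * M₁ x).trace)
      (((M b)⁻¹ * M₂).trace - ((M b)⁻¹ * M₁ b * ((M b)⁻¹ * M₁ b)).trace) b := by
  convert ((hM.inv h).mul hM₁).trace using 1
  rw [Matrix.trace_add, Matrix.neg_mul, Matrix.trace_neg]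
  simp only [Matrix.mul_assoc]
  ring

end EntryDeriv

/-! ### Invariance and absolute continuity of the matrix Gaussian law -/

section Gaussian

variable {ι : Type*} [Fintype ι]

theorem pi_absolutelyContinuous_fin (m : ℕ) {μ ν : Measure ℝ} [SigmaFinite μ] [SigmaFinite ν]
    (h : μ ≪ ν) : Measure.pi (fun _ : Fin m => μ) ≪ Measure.pi (fun _ : Fin m => ν) := by
  induction m with
  | zero =>
    rw [Measure.pi_of_empty, Measure.pi_of_empty]
  | succ m ih =>
    have h1 := (measurePreserving_piFinSuccAbove (fun _ : Fin (m + 1) => μ) 0).symm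
    have h2 := (measurePreserving_piFinSuccAbove (fun _ : Fin (m + 1) => ν) 0).symm
    rw [← h1.map_eq, ← h2.map_eq]
    exact (h.prod ih).map (MeasurableEquiv.measurable _)

theorem stdGaussian_absolutelyContinuous :
    stdGaussian (EuclideanSpace ℝ ι) ≪ (volume : Measure (EuclideanSpace ℝ ι)) := by
  have h1 : stdGaussian (EuclideanSpace ℝ ι)
      = (stdGaussian (EuclideanSpace ℝ (Fin (Fintype.card ι)))).map
        (LinearIsometryEquiv.piLpCongrLeft 2 ℝ ℝ (Fintype.equivFin ι).symm) :=
    (stdGaussian_map _).symm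
  have h2 : (volume : Measure (EuclideanSpace ℝ ι))
      = (volume : Measure (EuclideanSpace ℝ (Fin (Fintype.card ι)))).map
        (LinearIsometryEquiv.piLpCongrLeft 2 ℝ ℝ (Fintype.equivFin ι).symm) :=
    (LinearIsometryEquiv.measurePreserving _).map_eq.symm
  rw [h1, h2]
  refine Measure.AbsolutelyContinuous.map ?_
    (LinearIsometryEquiv.piLpCongrLeft 2 ℝ ℝ (Fintype.equivFin ι).symm).continuous.measurable
  rw [← map_pi_eq_stdGaussian, ← (PiLp.volume_preserving_toLp (Fin (Fintype.card ι))).map_eq]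
  refine Measure.AbsolutelyContinuous.map ?_ (WithLp.measurable_toLp _ _)
  rw [volume_pi]
  exact pi_absolutelyContinuous_fin _ (gaussianReal_absolutelyContinuous 0 one_ne_zero)

variable [DecidableEq ι]

/-- A linear map that fixes the covariance matrix preserves the centred Gaussian law. -/
theorem measurePreserving_multivariateGaussian {S M : Matrix ι ι ℝ} (hS : S.PosSemidef)
    (hM : M * S * Mᵀ = S) :
    MeasurePreserving (fun x : EuclideanSpace ℝ ι => WithLp.toLp 2 (M *ᵥ x.ofLp))
      (multivariateGaussian 0 S) (multivariateGaussian 0 S) := by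
  have hmeas : Measurable (fun x : EuclideanSpace ℝ ι => WithLp.toLp 2 (M *ᵥ x.ofLp)) := by
    have := (toEuclideanCLM (𝕜 := ℝ) M).measurable
    exact this
  refine ⟨hmeas, ?_⟩
  have := Measure.isProbabilityMeasure_map (μ := multivariateGaussian 0 S) hmeas.aemeasurable
  apply Measure.ext_of_charFun
  ext t
  have h1 : charFun ((multivariateGaussian 0 S).map
      (fun x : EuclideanSpace ℝ ι => WithLp.toLp 2 (M *ᵥ x.ofLp))) t
      = charFun (multivariateGaussian 0 S) (WithLp.toLp 2 (Mᵀ *ᵥ t.ofLp)) := by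
    rw [charFun_apply, charFun_apply, integral_map hmeas.aemeasurable (by fun_prop)]
    congr 1
    ext x
    congr 3
    simp only [EuclideanSpace.inner_eq_star_dotProduct, star_trivial]
    rw [Matrix.dotProduct_mulVec, Matrix.mulVec_transpose]
  rw [h1, charFun_multivariateGaussian hS, charFun_multivariateGaussian hS]
  congr 2
  · simp
  · congr 2
    conv_rhs => rw [← hM]
    simp only [← Matrix.mulVec_mulVec]
    rw [Matrix.dotProduct_mulVec t.ofLp M, Matrix.mulVec_transpose]

open scoped MatrixOrder in
theorem multivariateGaussian_absolutelyContinuous {S : Matrix ι ι ℝ} (hS : S.PosDef) :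
    multivariateGaussian (0 : EuclideanSpace ℝ ι) S ≪ volume := by
  have hdet : (CFC.sqrt S).det ≠ 0 := by
    have h : CFC.sqrt S * CFC.sqrt S = S := CFC.sqrt_mul_sqrt_self S hS.posSemidef.nonneg
    intro h0
    have := congrArg Matrix.det h
    rw [Matrix.det_mul, h0, zero_mul] at this
    exact hS.det_pos.ne this
  have hL : LinearMap.det (Matrix.toLin (EuclideanSpace.basisFun ι ℝ).toBasis
      (EuclideanSpace.basisFun ι ℝ).toBasis (CFC.sqrt S)) ≠ 0 := by
    rwa [LinearMap.det_toLin]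
  have h1 : multivariateGaussian (0 : EuclideanSpace ℝ ι) S
      = (stdGaussian (EuclideanSpace ℝ ι)).map (Matrix.toLin (EuclideanSpace.basisFun ι ℝ).toBasis
      (EuclideanSpace.basisFun ι ℝ).toBasis (CFC.sqrt S)) := by
    rw [multivariateGaussian]
    congr 1
    ext x : 1
    rw [zero_add]
    rfl
  rw [h1]
  have hmeas : Measurable (Matrix.toLin (EuclideanSpace.basisFun ι ℝ).toBasis
      (EuclideanSpace.basisFun ι ℝ).toBasis (CFC.sqrt S)) :=
    (LinearMap.continuous_of_finiteDimensional _).measurable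
  refine (stdGaussian_absolutelyContinuous.map hmeas).trans ?_
  rw [Measure.map_linearMap_addHaar_eq_smul_addHaar _ hL]
  exact Measure.smul_absolutelyContinuous

end Gaussian

section Law

variable {n k : ℕ}

theorem measurable_entry (i : Fin n) (r : Fin k) :
    Measurable (fun Y : Matrix (Fin n) (Fin k) ℝ => Y i r) := by
  have h1 : Measurable (fun f : Fin n → Fin k → ℝ => f i) := measurable_pi_apply i
  exact (measurable_pi_apply r).comp h1

theorem measurable_matrix_iff {Ω : Type*} [MeasurableSpace Ω] {F : Ω → Matrix (Fin n) (Fin k) ℝ}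
    (h : ∀ i r, Measurable fun ω => F ω i r) : Measurable F :=
  measurable_pi_iff.2 fun i => measurable_pi_iff.2 fun r => h i r

/-- The linear map with matrix `M` in the coordinates `(i, r)` of an `n × k` matrix. -/
def vecAct (M : Matrix (Fin n × Fin k) (Fin n × Fin k) ℝ) (Y : Matrix (Fin n) (Fin k) ℝ) :
    Matrix (Fin n) (Fin k) ℝ :=
  Matrix.of fun i r => (M *ᵥ fun p => Y p.1 p.2) (i, r)

theorem measurePreserving_vecAct {Γ : Matrix (Fin n) (Fin n) ℝ} {S : Matrix (Fin k) (Fin k) ℝ}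
    (hΓ : Γ.PosDef) (hS : S.PosDef) {M : Matrix (Fin n × Fin k) (Fin n × Fin k) ℝ}
    (hM : M * (Γ ⊗ₖ S) * Mᵀ = Γ ⊗ₖ S) :
    MeasurePreserving (vecAct M) (law Γ S) (law Γ S) := by
  have hmeas : Measurable (vecAct (n := n) (k := k) M) := by
    refine measurable_matrix_iff fun i r => ?_
    simp only [vecAct, Matrix.of_apply, Matrix.mulVec, dotProduct]
    exact Finset.measurable_sum _ fun p _ => (measurable_entry p.1 p.2).const_mul _
  have hp := measurePreserving_multivariateGaussian (hΓ.kronecker hS).posSemidef hM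
  refine ⟨hmeas, ?_⟩
  unfold law
  rw [Measure.map_map hmeas (measurable_toMatrix n k)]
  conv_rhs => rw [← hp.map_eq, Measure.map_map (measurable_toMatrix n k) hp.measurable]
  rfl

theorem measurable_det {Ω κ : Type*} [MeasurableSpace Ω] [Fintype κ] [DecidableEq κ]
    {F : Ω → Matrix κ κ ℝ} (h : ∀ i j, Measurable fun ω => F ω i j) :
    Measurable fun ω => (F ω).det := by
  simp only [Matrix.det_apply']
  exact Finset.measurable_sum _ fun σ _ =>
    (Finset.measurable_fun_prod _ fun i _ => h _ _).const_mul _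

/-- Almost surely no square minor vanishes: along the line `t ↦ Y + t E`, with `E` the partial
identity matrix of the minor, the minor is a monic polynomial in `t`. -/
theorem ae_det_submatrix_ne_zero {Γ : Matrix (Fin n) (Fin n) ℝ} {S : Matrix (Fin k) (Fin k) ℝ}
    (hΓ : Γ.PosDef) (hS : S.PosDef) {κ : Type*} [Fintype κ] [DecidableEq κ] {e : κ → Fin n}
    {f : κ → Fin k} (he : e.Injective) (hf : f.Injective) :
    ∀ᵐ Y ∂(law Γ S), (Y.submatrix e f).det ≠ 0 := by
  have hmeas : MeasurableSet {Y : Matrix (Fin n) (Fin k) ℝ | (Y.submatrix e f).det ≠ 0} := by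
    have : Measurable (fun Y : Matrix (Fin n) (Fin k) ℝ => (Y.submatrix e f).det) :=
      measurable_det fun i j => measurable_entry _ _
    exact this (MeasurableSet.singleton 0).compl
  unfold law
  refine (ae_map_iff (measurable_toMatrix n k).aemeasurable hmeas).2 ?_
  refine (multivariateGaussian_absolutelyContinuous (hΓ.kronecker hS)).ae_le ?_
  let E : EuclideanSpace ℝ (Fin n × Fin k) :=
    WithLp.toLp 2 fun p => if ∃ a, e a = p.1 ∧ f a = p.2 then 1 else 0
  refine ae_mem_of_ae_add_linearMap_mem (LinearMap.toSpanSingleton ℝ _ E) volume volume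
    (measurable_toMatrix n k hmeas) fun x => ?_
  set X : Matrix κ κ ℝ := Matrix.of fun a b => x (e a, f b) with hX
  have hfin : {t : ℝ | (-X).charpoly.IsRoot t}.Finite :=
    Polynomial.finite_setOfPred_isRoot (Matrix.charpoly_monic _).ne_zero
  have h0 := hfin.countable.ae_notMem (volume : Measure ℝ)
  filter_upwards [h0] with t ht
  intro hdet
  apply ht
  change (-X).charpoly.eval t = 0
  rw [Matrix.eval_charpoly, ← hdet]
  congr 1
  ext a b
  have hE : (∃ c, e c = e a ∧ f c = f b) ↔ a = b :=
    ⟨fun ⟨c, h1, h2⟩ => (he h1).symm.trans (hf h2), fun h => ⟨a, rfl, by rw [h]⟩⟩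
  simp only [Matrix.sub_apply, Matrix.neg_apply, Matrix.submatrix_apply, Matrix.of_apply,
    LinearMap.toSpanSingleton_apply, PiLp.add_apply, PiLp.smul_apply, smul_eq_mul, E, hE, hX,
    Matrix.scalar_apply, Matrix.diagonal_apply]
  split_ifs <;> ring

end Law

/-! ### Tensors invariant under the orthogonal group -/

section Tensor

variable {ι : Type*} [Fintype ι] [DecidableEq ι]

theorem permMatrix_mul_transpose (σ : Equiv.Perm ι) :
    (Matrix.of fun i a => if σ i = a then (1 : ℝ) else 0) *
      (Matrix.of fun i a => if σ i = a then (1 : ℝ) else 0)ᵀ = 1 := by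
  ext i j
  simp [Matrix.mul_apply, Matrix.one_apply, eq_comm]

theorem flip_mul_transpose (x : ι) :
    (Matrix.diagonal fun i => if i = x then (-1 : ℝ) else 1) *
      (Matrix.diagonal fun i => if i = x then (-1 : ℝ) else 1)ᵀ = 1 := by
  rw [Matrix.diagonal_transpose, Matrix.diagonal_mul_diagonal, ← Matrix.diagonal_one]
  congr 1
  ext i
  split_ifs <;> norm_num

/-- An invariant tensor of order two is a multiple of the identity. -/
theorem tensor_two_eq {m : ι → ι → ℝ}
    (hm : ∀ O : Matrix ι ι ℝ, O * Oᵀ = 1 → ∀ i j, m i j = ∑ a, ∑ b, O i a * O j b * m a b) :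
    ∃ c : ℝ, ∀ i j, m i j = if i = j then c else 0 := by
  rcases isEmpty_or_nonempty ι with h | ⟨⟨i₀⟩⟩
  · exact ⟨0, fun i => (h.false i).elim⟩
  refine ⟨m i₀ i₀, fun i j => ?_⟩
  split_ifs with hij
  · subst hij
    rw [hm _ (permMatrix_mul_transpose (Equiv.swap i₀ i)) i₀ i₀]
    simp
  · have := hm _ (flip_mul_transpose i) i j
    simp [Matrix.diagonal_apply, Ne.symm hij] at this
    linarith

/-- The reflection in the hyperplane orthogonal to `e_x - 2 e_y`; it maps `e_x` to
`(3 e_x + 4 e_y) / 5`. -/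
theorem householder_mul_transpose {x y : ι} (hxy : x ≠ y) :
    ∃ O : Matrix ι ι ℝ, O * Oᵀ = 1 ∧
      ∀ a, O x a = (if a = x then (3 / 5 : ℝ) else 0) + (if a = y then (4 / 5 : ℝ) else 0) := by
  let v : ι → ℝ := fun a => (if a = x then (1 : ℝ) else 0) - (if a = y then (2 : ℝ) else 0)
  have hv : v ⬝ᵥ v = 5 := by
    simp only [v, dotProduct, sub_mul, mul_sub, Finset.sum_sub_distrib]
    simp [hxy, hxy.symm]
    norm_num
  refine ⟨1 - (2 / 5 : ℝ) • Matrix.vecMulVec v v, ?_, fun a => ?_⟩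
  · rw [Matrix.transpose_sub, Matrix.transpose_smul, Matrix.transpose_vecMulVec,
      Matrix.transpose_one]
    have : Matrix.vecMulVec v v * Matrix.vecMulVec v v = (5 : ℝ) • Matrix.vecMulVec v v := by
      rw [Matrix.vecMulVec_mul_vecMulVec, hv]
      simp [Matrix.vecMulVec_smul]
    simp only [sub_mul, mul_sub, Matrix.one_mul, Matrix.mul_one, Matrix.smul_mul,
      Matrix.mul_smul, this]
    module
  · simp only [Matrix.sub_apply, Matrix.one_apply, Matrix.smul_apply, Matrix.vecMulVec_apply,
      smul_eq_mul, v, if_neg hxy, if_true, eq_comm (a := x) (b := a)]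
    split_ifs <;> norm_num

theorem exists_perm_pair {ι : Type*} [DecidableEq ι] {x y x' y' : ι} (h : x ≠ y) (h' : x' ≠ y') :
    ∃ σ : Equiv.Perm ι, σ x = x' ∧ σ y = y' := by
  refine ⟨Equiv.swap (Equiv.swap x x' y) y' * Equiv.swap x x', ?_, ?_⟩
  · rw [Equiv.Perm.mul_apply, Equiv.swap_apply_left, Equiv.swap_apply_of_ne_of_ne _ h']
    intro h0
    apply h
    apply (Equiv.swap x x').injective
    rw [← h0, Equiv.swap_apply_left]
  · rw [Equiv.Perm.mul_apply, Equiv.swap_apply_left]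

/-- An invariant tensor of order four with the symmetries of `P ⊗ P`, `P` symmetric, is a
combination of the two isotropic tensors with these symmetries. -/
theorem tensor_four_eq {m : ι → ι → ι → ι → ℝ}
    (hm : ∀ O : Matrix ι ι ℝ, O * Oᵀ = 1 → ∀ i j k l, m i j k l =
      ∑ a, ∑ b, ∑ c, ∑ d, O i a * O j b * (O k c * O l d) * m a b c d)
    (hs : ∀ i j k l, m i j k l = m j i k l) (hs' : ∀ i j k l, m i j k l = m i j l k) :
    ∃ α β : ℝ, ∀ i j k l, m i j k l =
      α * ((if i = j then 1 else 0) * (if k = l then 1 else 0)) +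
      β * ((if i = k then 1 else 0) * (if j = l then 1 else 0) +
        (if i = l then 1 else 0) * (if j = k then 1 else 0)) := by
  -- a component vanishes unless every index occurs an even number of times
  have hflip : ∀ x i j k l, m i j k l = (if i = x then (-1 : ℝ) else 1) *
      (if j = x then (-1 : ℝ) else 1) * ((if k = x then (-1 : ℝ) else 1) *
      (if l = x then (-1 : ℝ) else 1)) * m i j k l := by
    intro x i j k l
    have := hm _ (flip_mul_transpose x) i j k l
    simpa [Matrix.diagonal_apply] using this
  have hperm : ∀ (σ : Equiv.Perm ι) i j k l, m i j k l = m (σ i) (σ j) (σ k) (σ l) := by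
    intro σ i j k l
    have := hm _ (permMatrix_mul_transpose σ) i j k l
    simpa using this
  -- the reflection that mixes `x` and `y` relates the three kinds of components
  have hrel : ∀ x y, x ≠ y → m x x x x = m x x y y + 2 * m x y x y := by
    intro x y hxy
    obtain ⟨O, hO, hOx⟩ := householder_mul_transpose hxy
    have h1 := hm O hO x x x x
    simp only [hOx, add_mul, mul_add, Finset.sum_add_distrib, ite_mul, mul_ite, zero_mul, mul_zero,
      Finset.sum_ite_eq', Finset.mem_univ, if_true] at h1
    have e1 := hflip x x x x y
    have e2 := hflip x x y y y
    simp [hxy.symm] at e1 e2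
    have e3 : m y y y y = m x x x x := by
      rw [hperm (Equiv.swap x y) x x x x]; simp
    have e4 : m y y x x = m x x y y := by
      rw [hperm (Equiv.swap x y) x x y y]; simp
    have f1 : m x x x y = 0 := by linarith
    have f2 : m x y y y = 0 := by linarith
    have f3 : m x x y x = 0 := by rw [hs']; exact f1
    have f4 : m x y x x = 0 := by
      have := hflip x x y x x
      simp [hxy.symm] at this; linarith
    have f5 : m y x x x = 0 := by rw [hs]; exact f4
    have f6 : m y x y y = 0 := by rw [hs]; exact f2
    have f7 : m y y x y = 0 := by
      have := hflip x y y x y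
      simp [hxy.symm] at this; linarith
    have f8 : m y y y x = 0 := by rw [hs']; exact f7
    have g1 : m x y y x = m x y x y := hs' _ _ _ _
    have g2 : m y x x y = m x y x y := hs _ _ _ _
    have g3 : m y x y x = m x y x y := by rw [hs, hs']
    rw [f1, f2, f3, f4, f5, f6, f7, f8, g1, g2, g3, e3, e4] at h1
    linarith
  have hdiag : ∀ x y, m x x x x = m y y y y := fun x y => by
    rw [hperm (Equiv.swap x y) x x x x]; simp
  rcases isEmpty_or_nonempty ι with h | ⟨⟨x⟩⟩
  · exact ⟨0, 0, fun i => (h.false i).elim⟩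
  by_cases hy : ∃ y, x ≠ y
  · obtain ⟨y, hxy⟩ := hy
    have hq : ∀ i j, i ≠ j → m i i j j = m x x y y := fun i j hij => by
      obtain ⟨σ, rfl, rfl⟩ := exists_perm_pair hxy hij
      exact (hperm σ _ _ _ _).symm
    have hr : ∀ i j, i ≠ j → m i j i j = m x y x y := fun i j hij => by
      obtain ⟨σ, rfl, rfl⟩ := exists_perm_pair hxy hij
      exact (hperm σ _ _ _ _).symm
    refine ⟨m x x y y, m x y x y, fun i j k l => ?_⟩
    by_cases hij : i = j
    · subst hij
      by_cases hkl : k = l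
      · subst hkl
        by_cases hik : i = k
        · subst hik
          rw [hdiag i x, hrel x y hxy]
          simp; ring
        · rw [hq i k hik]; simp [hik]
      · have h1 := hflip k i i k l
        have h2 := hflip l i i k l
        by_cases hik : i = k
        · subst hik; simp [hkl, Ne.symm hkl] at h1 h2 ⊢; linarith
        · simp [hik, hkl, Ne.symm hkl] at h1 ⊢; linarith
    · by_cases hkl : k = l
      · subst hkl
        have h1 := hflip i i j k k
        have h2 := hflip j i j k k
        by_cases hik : i = k
        · subst hik; simp [hij, Ne.symm hij] at h1 h2 ⊢; linarith
        · simp [hik, hij, Ne.symm hij, Ne.symm hik] at h1 ⊢; linarith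
      · by_cases hik : i = k
        · subst hik
          by_cases hjl : j = l
          · subst hjl
            rw [hr i j hij]; simp [hij]
          · have h1 := hflip j i j i l
            simp [hij, hjl, hkl, Ne.symm hij, Ne.symm hjl] at h1 ⊢; linarith
        · by_cases hil : i = l
          · subst hil
            by_cases hjk : j = k
            · subst hjk
              rw [hs', hr i j hij]; simp [hij]
            · have h1 := hflip j i j k i
              simp [hij, hik, hjk, Ne.symm hjk] at h1 ⊢; linarith
          · have h1 := hflip i i j k l
            simp [hik, hij, hil, Ne.symm hij, Ne.symm hik, Ne.symm hil] at h1 ⊢; linarith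
  · push Not at hy
    refine ⟨m x x x x, 0, fun i j k l => ?_⟩
    rw [← hy i, ← hy j, ← hy k, ← hy l]
    simp

end Tensor

/-! ### Moments of rotation-invariant random projections -/

section Projection

variable {Ω : Type*} [MeasurableSpace Ω] {μ : Measure Ω} {ι : Type*} [Fintype ι] [DecidableEq ι]

/-- `P` is a random orthogonal projection of rank `k` on `ℝ^ι` whose law is invariant under
rotations. The invariance is realised by measure-preserving maps of the underlying space. -/
structure IsInvariantProjection (μ : Measure Ω) (P : Ω → Matrix ι ι ℝ) (k : ℝ) : Prop where
  measurable : ∀ i j, Measurable fun ω => P ω i j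
  isSymm : ∀ ω, (P ω).IsSymm
  idem : ∀ᵐ ω ∂μ, P ω * P ω = P ω
  trace_eq : ∀ᵐ ω ∂μ, (P ω).trace = k
  invariant : ∀ O : Matrix ι ι ℝ, O * Oᵀ = 1 →
    ∃ T : Ω → Ω, MeasurePreserving T μ μ ∧ ∀ ω, P (T ω) = O * P ω * Oᵀ

theorem integral_comp_of_measurePreserving {T : Ω → Ω} (hT : MeasurePreserving T μ μ) {F : Ω → ℝ}
    (hF : Measurable F) : ∫ ω, F (T ω) ∂μ = ∫ ω, F ω ∂μ := by
  conv_rhs => rw [← hT.map_eq]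
  exact (integral_map hT.measurable.aemeasurable hF.aestronglyMeasurable).symm

omit [DecidableEq ι] in
theorem conj_apply (O P : Matrix ι ι ℝ) (i j : ι) :
    (O * P * Oᵀ) i j = ∑ a, ∑ b, O i a * O j b * P a b := by
  simp only [Matrix.mul_apply, Matrix.transpose_apply, Finset.sum_mul]
  rw [Finset.sum_comm]
  exact Finset.sum_congr rfl fun a _ => Finset.sum_congr rfl fun b _ => by ring

omit [DecidableEq ι] in
theorem trace_mul_eq_sum (P A : Matrix ι ι ℝ) : (P * A).trace = ∑ i, ∑ j, A j i * P i j := by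
  simp only [Matrix.trace, Matrix.diag_apply, Matrix.mul_apply, mul_comm]

omit [DecidableEq ι] in
theorem trace_mul_mul_mul_eq_sum (P A : Matrix ι ι ℝ) : (P * A * (P * A)).trace =
    ∑ i, ∑ j, ∑ a, ∑ b, A j a * A b i * (P i j * P a b) := by
  simp only [Matrix.trace, Matrix.diag_apply, Matrix.mul_apply, Finset.sum_mul_sum]
  refine Finset.sum_congr rfl fun i _ => ?_
  rw [Finset.sum_comm]
  exact Finset.sum_congr rfl fun j _ => Finset.sum_congr rfl fun a _ =>
    Finset.sum_congr rfl fun b _ => by ring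

omit [DecidableEq ι] in
theorem trace_mul_sq_eq_sum (P A : Matrix ι ι ℝ) : (P * A).trace ^ 2 =
    ∑ i, ∑ j, ∑ a, ∑ b, A j i * A b a * (P i j * P a b) := by
  rw [trace_mul_eq_sum, sq, Finset.sum_mul]
  refine Finset.sum_congr rfl fun i _ => ?_
  rw [Finset.sum_mul]
  refine Finset.sum_congr rfl fun j _ => ?_
  rw [Finset.mul_sum]
  refine Finset.sum_congr rfl fun a _ => ?_
  rw [Finset.mul_sum]
  exact Finset.sum_congr rfl fun b _ => by ring

/-- An entry of an orthogonal projection is at most one in absolute value. -/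
theorem abs_entry_le_one {ι : Type*} [Fintype ι] {P : Matrix ι ι ℝ} (hs : P.IsSymm) (hi : P * P = P) (i j : ι) :
    |P i j| ≤ 1 := by
  have h1 : ∀ i j, P i j ^ 2 ≤ P i i := fun i j => by
    conv_rhs => rw [← hi, Matrix.mul_apply]
    have : P i j ^ 2 = P i j * P j i := by rw [hs.apply, sq]
    rw [this]
    exact Finset.single_le_sum (f := fun j => P i j * P j i)
      (fun l _ => by rw [hs.apply]; exact mul_self_nonneg _) (Finset.mem_univ j)
  have h2 : P i i ≤ 1 := by nlinarith [h1 i i]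
  exact abs_le_one_iff_mul_self_le_one.2 (by nlinarith [h1 i j])

namespace IsInvariantProjection

variable {P : Ω → Matrix ι ι ℝ} {k : ℝ}

theorem memLp_entry [IsProbabilityMeasure μ] (h : IsInvariantProjection μ P k) (i j : ι)
    (p : ENNReal) : MemLp (fun ω => P ω i j) p μ :=
  MemLp.of_bound (h.measurable i j).aestronglyMeasurable 1 <| by
    filter_upwards [h.idem] with ω hω
    exact abs_entry_le_one (h.isSymm ω) hω i j

theorem memLp_trace_mul [IsProbabilityMeasure μ] (h : IsInvariantProjection μ P k)
    (A : Matrix ι ι ℝ) (p : ENNReal) : MemLp (fun ω => (P ω * A).trace) p μ := by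
  simp only [trace_mul_eq_sum]
  exact memLp_finsetSum _ fun i _ => memLp_finsetSum _ fun j _ =>
    (h.memLp_entry i j p).const_mul _

theorem measurable_trace_mul (h : IsInvariantProjection μ P k) (A : Matrix ι ι ℝ) :
    Measurable (fun ω => (P ω * A).trace) := by
  simp only [trace_mul_eq_sum]
  exact Finset.measurable_sum _ fun i _ => Finset.measurable_sum _ fun j _ =>
    (h.measurable i j).const_mul _

theorem integrable_mul [IsProbabilityMeasure μ] (h : IsInvariantProjection μ P k) (i j a b : ι) :
    Integrable (fun ω => P ω i j * P ω a b) μ :=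
  (h.memLp_entry i j 2).integrable_mul (h.memLp_entry a b 2)

theorem integrable_trace_mul_mul_mul [IsProbabilityMeasure μ] (h : IsInvariantProjection μ P k)
    (A : Matrix ι ι ℝ) : Integrable (fun ω => (P ω * A * (P ω * A)).trace) μ := by
  simp only [trace_mul_mul_mul_eq_sum]
  exact integrable_finsetSum _ fun i _ => integrable_finsetSum _ fun j _ =>
    integrable_finsetSum _ fun a _ => integrable_finsetSum _ fun b _ =>
    (h.integrable_mul i j a b).const_mul _

theorem integral_sum_mul [IsProbabilityMeasure μ] (h : IsInvariantProjection μ P k)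
    (C : ι → ι → ι → ι → ℝ) :
    ∫ ω, ∑ i, ∑ j, ∑ a, ∑ b, C i j a b * (P ω i j * P ω a b) ∂μ =
      ∑ i, ∑ j, ∑ a, ∑ b, C i j a b * ∫ ω, P ω i j * P ω a b ∂μ := by
  have I := fun i j a b => (h.integrable_mul i j a b).const_mul (C i j a b)
  rw [integral_finsetSum _ fun i _ => integrable_finsetSum _ fun j _ =>
    integrable_finsetSum _ fun a _ => integrable_finsetSum _ fun b _ => I i j a b]
  refine Finset.sum_congr rfl fun i _ => ?_
  rw [integral_finsetSum _ fun j _ =>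
    integrable_finsetSum _ fun a _ => integrable_finsetSum _ fun b _ => I i j a b]
  refine Finset.sum_congr rfl fun j _ => ?_
  rw [integral_finsetSum _ fun a _ => integrable_finsetSum _ fun b _ => I i j a b]
  refine Finset.sum_congr rfl fun a _ => ?_
  rw [integral_finsetSum _ fun b _ => I i j a b]
  exact Finset.sum_congr rfl fun b _ => integral_const_mul _ _

/-- The second moments of an invariant random projection form an invariant tensor, hence are
determined by two constants. -/
theorem exists_integral_eq [IsProbabilityMeasure μ] (h : IsInvariantProjection μ P k) :
    ∃ α β : ℝ, ∀ A : Matrix ι ι ℝ, A.IsSymm →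
      ∫ ω, (P ω * A).trace ^ 2 ∂μ = α * A.trace ^ 2 + 2 * β * (A * A).trace ∧
      ∫ ω, (P ω * A * (P ω * A)).trace ∂μ =
        α * (A * A).trace + β * ((A * A).trace + A.trace ^ 2) := by
  obtain ⟨α, β, hm⟩ := tensor_four_eq (m := fun i j a b => ∫ ω, P ω i j * P ω a b ∂μ)
    (by
      intro O hO i j a b
      obtain ⟨T, hT, hPT⟩ := h.invariant O hO
      have h1 := integral_comp_of_measurePreserving hT
        ((h.measurable i j).mul (h.measurable a b))
      simp only [Pi.mul_apply] at h1
      rw [← h1, ← h.integral_sum_mul]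
      congr 1
      ext ω
      rw [hPT, conj_apply, conj_apply, Finset.sum_mul]
      refine Finset.sum_congr rfl fun i _ => ?_
      rw [Finset.sum_mul]
      refine Finset.sum_congr rfl fun j _ => ?_
      rw [Finset.mul_sum]
      refine Finset.sum_congr rfl fun a _ => ?_
      rw [Finset.mul_sum]
      exact Finset.sum_congr rfl fun b _ => by ring)
    (fun i j a b => by simp only [(h.isSymm _).apply i j])
    (fun i j a b => by simp only [(h.isSymm _).apply a b])
  have hC : ∀ C : ι → ι → ι → ι → ℝ,
      ∫ ω, ∑ i, ∑ j, ∑ a, ∑ b, C i j a b * (P ω i j * P ω a b) ∂μ =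
        α * ∑ i, ∑ a, C i i a a + β * ((∑ i, ∑ j, C i j i j) + ∑ i, ∑ j, C i j j i) := by
    intro C
    rw [h.integral_sum_mul]
    simp only [hm]
    have t : ∀ i j a b, C i j a b * (α * ((if i = j then 1 else 0) * (if a = b then 1 else 0)) +
        β * ((if i = a then 1 else 0) * (if j = b then 1 else 0) +
          (if i = b then 1 else 0) * (if j = a then 1 else 0))) =
        (if i = j then if a = b then α * C i j a b else 0 else 0) +
        ((if i = a then if j = b then β * C i j a b else 0 else 0) +
          (if i = b then if j = a then β * C i j a b else 0 else 0)) := by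
      intro i j a b
      split_ifs <;> ring
    simp only [t]
    simp only [Finset.sum_add_distrib, Finset.sum_ite_irrel, Finset.sum_const_zero,
      Finset.sum_ite_eq, Finset.mem_univ, if_true, Finset.mul_sum, mul_add]
  refine ⟨α, β, fun A hA => ⟨?_, ?_⟩⟩
  · simp only [trace_mul_sq_eq_sum]
    rw [hC]
    have e1 : A.trace ^ 2 = ∑ i, ∑ a, A i i * A a a := by
      rw [sq, Matrix.trace, Finset.sum_mul_sum]; rfl
    have e2 : (A * A).trace = ∑ i, ∑ j, A j i * A j i := by
      rw [trace_mul_eq_sum]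
      exact Finset.sum_congr rfl fun i _ => Finset.sum_congr rfl fun j _ => by rw [hA.apply i j]
    have e3 : (A * A).trace = ∑ i, ∑ j, A j i * A i j := trace_mul_eq_sum A A
    rw [← e1, ← e2, ← e3]
    ring
  · simp only [trace_mul_mul_mul_eq_sum]
    rw [hC]
    have e1 : A.trace ^ 2 = ∑ i, ∑ a, A a a * A i i := by
      rw [sq, Matrix.trace, Finset.sum_mul_sum]
      exact Finset.sum_congr rfl fun i _ => Finset.sum_congr rfl fun j _ => mul_comm _ _
    have e2 : (A * A).trace = ∑ i, ∑ j, A j i * A j i := by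
      rw [trace_mul_eq_sum]
      exact Finset.sum_congr rfl fun i _ => Finset.sum_congr rfl fun j _ => by rw [hA.apply i j]
    have e3 : (A * A).trace = ∑ i, ∑ j, A i j * A j i := by
      rw [trace_mul_eq_sum]
      exact Finset.sum_congr rfl fun i _ => Finset.sum_congr rfl fun j _ => mul_comm _ _
    rw [← e1, ← e2, ← e3]

/-- The second moments of an invariant random projection of rank `k`: the constants are pinned down
by the cases of `(tr P)² = k²` and `tr (P P) = k`. -/
theorem integral_second_moments [IsProbabilityMeasure μ] (h : IsInvariantProjection μ P k) :
    ∃ α β : ℝ, α * Fintype.card ι ^ 2 + 2 * β * Fintype.card ι = k ^ 2 ∧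
      α * Fintype.card ι + β * (Fintype.card ι + Fintype.card ι ^ 2) = k ∧
      ∀ A : Matrix ι ι ℝ, A.IsSymm →
      ∫ ω, (P ω * A).trace ^ 2 ∂μ = α * A.trace ^ 2 + 2 * β * (A * A).trace ∧
      ∫ ω, (P ω * A * (P ω * A)).trace ∂μ =
        α * (A * A).trace + β * ((A * A).trace + A.trace ^ 2) := by
  obtain ⟨α, β, hA⟩ := h.exists_integral_eq
  refine ⟨α, β, ?_, ?_, hA⟩
  · have h1 := (hA 1 Matrix.isSymm_one).1
    simp only [Matrix.mul_one, Matrix.trace_one] at h1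
    rw [← h1, integral_congr_ae (g := fun _ => k ^ 2)]
    · simp
    · filter_upwards [h.trace_eq] with ω hω
      rw [hω]
  · have h1 := (hA 1 Matrix.isSymm_one).2
    simp only [Matrix.mul_one, Matrix.trace_one] at h1
    rw [← h1, integral_congr_ae (g := fun _ => k)]
    · simp
    · filter_upwards [h.trace_eq, h.idem] with ω hω hi
      rw [hi, hω]

/-- The mean of an invariant random projection is a multiple of the identity, also when it is
weighted by a bounded function that is invariant under the same rotations. -/
theorem card_mul_integral_weight [IsProbabilityMeasure μ] (h : IsInvariantProjection μ P k)
    {g : Ω → ℝ} (hg : MemLp g 2 μ) (hgm : Measurable g)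
    (hinv : ∀ O : Matrix ι ι ℝ, O * Oᵀ = 1 → ∃ T : Ω → Ω, MeasurePreserving T μ μ ∧
      (∀ ω, P (T ω) = O * P ω * Oᵀ) ∧ ∀ ω, g (T ω) = g ω) (A : Matrix ι ι ℝ) :
    Fintype.card ι * ∫ ω, g ω * (P ω * A).trace ∂μ = k * A.trace * ∫ ω, g ω ∂μ := by
  have I : ∀ i j, Integrable (fun ω => g ω * P ω i j) μ := fun i j =>
    hg.integrable_mul (h.memLp_entry i j 2)
  have hsum : ∀ C : ι → ι → ℝ, ∫ ω, ∑ i, ∑ j, C i j * (g ω * P ω i j) ∂μ =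
      ∑ i, ∑ j, C i j * ∫ ω, g ω * P ω i j ∂μ := by
    intro C
    rw [integral_finsetSum _ fun i _ => integrable_finsetSum _ fun j _ => (I i j).const_mul _]
    refine Finset.sum_congr rfl fun i _ => ?_
    rw [integral_finsetSum _ fun j _ => (I i j).const_mul _]
    exact Finset.sum_congr rfl fun j _ => integral_const_mul _ _
  obtain ⟨c, hc⟩ := tensor_two_eq (m := fun i j => ∫ ω, g ω * P ω i j ∂μ) (by
    intro O hO i j
    obtain ⟨T, hT, hPT, hgT⟩ := hinv O hO
    have h1 := integral_comp_of_measurePreserving hT (hgm.mul (h.measurable i j))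
    simp only [Pi.mul_apply] at h1
    rw [← h1, ← hsum]
    congr 1
    ext ω
    rw [hPT, hgT, conj_apply, Finset.mul_sum]
    refine Finset.sum_congr rfl fun i _ => ?_
    rw [Finset.mul_sum]
    exact Finset.sum_congr rfl fun j _ => by ring)
  have hA : ∀ A : Matrix ι ι ℝ, ∫ ω, g ω * (P ω * A).trace ∂μ = c * A.trace := by
    intro A
    have : ∀ ω, g ω * (P ω * A).trace = ∑ i, ∑ j, A j i * (g ω * P ω i j) := by
      intro ω
      rw [trace_mul_eq_sum, Finset.mul_sum]
      refine Finset.sum_congr rfl fun i _ => ?_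
      rw [Finset.mul_sum]
      exact Finset.sum_congr rfl fun j _ => by ring
    simp only [this, hsum, hc]
    simp only [mul_ite, mul_zero, Finset.sum_ite_eq, Finset.mem_univ, if_true, Matrix.trace,
      Matrix.diag_apply, Finset.mul_sum, mul_comm]
  have h1 := hA 1
  simp only [Matrix.mul_one, Matrix.trace_one] at h1
  have h2 : ∫ ω, g ω * (P ω).trace ∂μ = k * ∫ ω, g ω ∂μ := by
    rw [← integral_const_mul]
    refine integral_congr_ae ?_
    filter_upwards [h.trace_eq] with ω hω
    rw [hω, mul_comm]
  rw [hA]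
  linear_combination A.trace * (h2 - h1)

theorem card_mul_integral [IsProbabilityMeasure μ] (h : IsInvariantProjection μ P k)
    (A : Matrix ι ι ℝ) :
    Fintype.card ι * ∫ ω, (P ω * A).trace ∂μ = k * A.trace := by
  have := h.card_mul_integral_weight (g := fun _ => 1) (memLp_const 1) measurable_const
    (fun O hO => by
      obtain ⟨T, hT, hP⟩ := h.invariant O hO
      exact ⟨T, hT, hP, fun _ => rfl⟩) A
  simpa using this

end IsInvariantProjection

end Projection

/-! ### The projection onto the column space -/

section HatMatrix

variable {ι κ : Type*} [Fintype ι] [Fintype κ] [DecidableEq κ]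

/-- The orthogonal projection onto the column space of `H`, if `H` has full column rank. -/
noncomputable def hatMatrix (H : Matrix ι κ ℝ) : Matrix ι ι ℝ :=
  H * (Hᵀ * H)⁻¹ * Hᵀ

theorem hatMatrix_isSymm (H : Matrix ι κ ℝ) : (hatMatrix H).IsSymm := by
  have : (Hᵀ * H)ᵀ = Hᵀ * H := by simp
  simp only [Matrix.IsSymm, hatMatrix, Matrix.transpose_mul, Matrix.transpose_transpose,
    Matrix.transpose_nonsing_inv, Matrix.mul_assoc]

theorem hatMatrix_mul_self {H : Matrix ι κ ℝ} (h : (Hᵀ * H).det ≠ 0) :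
    hatMatrix H * hatMatrix H = hatMatrix H := by
  have e : hatMatrix H * hatMatrix H = H * ((Hᵀ * H)⁻¹ * (Hᵀ * H)) * (Hᵀ * H)⁻¹ * Hᵀ := by
    simp only [hatMatrix, Matrix.mul_assoc]
  rw [e, Matrix.nonsing_inv_mul _ (isUnit_iff_ne_zero.2 h), Matrix.mul_one, hatMatrix]

theorem trace_hatMatrix {H : Matrix ι κ ℝ} (h : (Hᵀ * H).det ≠ 0) :
    (hatMatrix H).trace = Fintype.card κ := by
  rw [hatMatrix, Matrix.trace_mul_comm, ← Matrix.mul_assoc,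
    Matrix.mul_nonsing_inv _ (isUnit_iff_ne_zero.2 h), Matrix.trace_one]

theorem hatMatrix_mul [DecidableEq ι] {O : Matrix ι ι ℝ} (hO : O * Oᵀ = 1) (H : Matrix ι κ ℝ) :
    hatMatrix (O * H) = O * hatMatrix H * Oᵀ := by
  have h : (O * H)ᵀ * (O * H) = Hᵀ * H := by
    rw [Matrix.transpose_mul, Matrix.mul_assoc, ← Matrix.mul_assoc Oᵀ, mul_eq_one_comm.1 hO,
      Matrix.one_mul]
  rw [hatMatrix, h, hatMatrix, Matrix.transpose_mul]
  simp only [Matrix.mul_assoc]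

theorem measurable_inv_entry {Ω : Type*} [MeasurableSpace Ω]
    {F : Ω → Matrix κ κ ℝ} (h : ∀ i j, Measurable fun ω => F ω i j) (i j : κ) :
    Measurable fun ω => (F ω)⁻¹ i j := by
  simp only [Matrix.inv_def, Ring.inverse_eq_inv', Matrix.smul_apply, smul_eq_mul,
    Matrix.adjugate_apply]
  refine (measurable_det h).inv.mul (measurable_det fun a b => ?_)
  by_cases ha : a = j
  · subst ha
    simp
  · simpa [Matrix.updateRow_ne ha] using h a b

omit [Fintype ι] [DecidableEq κ] in
theorem measurable_mul_entry {Ω ν : Type*} [MeasurableSpace Ω] {F : Ω → Matrix ι κ ℝ}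
    {F' : Ω → Matrix κ ν ℝ} (h : ∀ i j, Measurable fun ω => F ω i j)
    (h' : ∀ i j, Measurable fun ω => F' ω i j) (i : ι) (j : ν) :
    Measurable fun ω => (F ω * F' ω) i j := by
  simp only [Matrix.mul_apply]
  exact Finset.measurable_sum _ fun l _ => (h i l).mul (h' l j)

theorem measurable_hatMatrix {Ω : Type*} [MeasurableSpace Ω] {H : Ω → Matrix ι κ ℝ}
    (h : ∀ i j, Measurable fun ω => H ω i j) (i j : ι) :
    Measurable fun ω => hatMatrix (H ω) i j :=
  measurable_mul_entry (measurable_mul_entry h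
    (measurable_inv_entry (measurable_mul_entry (fun i j => h j i) h))) (fun i j => h j i) i j

theorem isInvariantProjection_hatMatrix [DecidableEq ι] {Ω : Type*} [MeasurableSpace Ω]
    {μ : Measure Ω} {H : Ω → Matrix ι κ ℝ} (hm : ∀ i j, Measurable fun ω => H ω i j)
    (hdet : ∀ᵐ ω ∂μ, ((H ω)ᵀ * H ω).det ≠ 0)
    (hinv : ∀ O : Matrix ι ι ℝ, O * Oᵀ = 1 →
      ∃ T : Ω → Ω, MeasurePreserving T μ μ ∧ ∀ ω, H (T ω) = O * H ω) :
    IsInvariantProjection μ (fun ω => hatMatrix (H ω)) (Fintype.card κ) where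
  measurable := measurable_hatMatrix hm
  isSymm ω := hatMatrix_isSymm _
  idem := hdet.mono fun ω hω => hatMatrix_mul_self hω
  trace_eq := hdet.mono fun ω hω => trace_hatMatrix hω
  invariant O hO := by
    obtain ⟨T, hT, hH⟩ := hinv O hO
    exact ⟨T, hT, fun ω => by rw [hH, hatMatrix_mul hO]⟩

end HatMatrix

/-! ### The concentrated log likelihood and its derivatives -/

section Concentrated

variable {ι κ : Type*} [Fintype ι] [DecidableEq ι] [Fintype κ] [DecidableEq κ]

/-- The log likelihood of `G`, up to an additive constant, after maximising over an unrestricted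
column covariance matrix. The profile log likelihoods of all three models are sums of such terms. -/
noncomputable def concentrated (X : Matrix ι κ ℝ) (G : Matrix ι ι ℝ) : ℝ :=
  -(Fintype.card κ / 2) * Real.log G.det
    - Fintype.card ι / 2 * Real.log (Xᵀ * G⁻¹ * X).det

/-- `G` is a curve of positive definite matrices with derivatives `G₁` and `G₂` on `B`. -/
structure IsSmoothCurve {ι : Type*} (B : Set ℝ) (G G₁ G₂ : ℝ → Matrix ι ι ℝ) : Prop where
  posDef : ∀ b ∈ B, (G b).PosDef
  hasDeriv : ∀ b ∈ B, HasEntryDerivAt G (G₁ b) b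
  hasDeriv₂ : ∀ b ∈ B, HasEntryDerivAt G₁ (G₂ b) b

theorem HasEntryDerivAt.isSymm {ι : Type*} {G : ℝ → Matrix ι ι ℝ} {G' : Matrix ι ι ℝ} {b : ℝ}
    (h : HasEntryDerivAt G G' b) (hs : ∀ᶠ x in nhds b, (G x).IsSymm) : G'.IsSymm := by
  have h2 : HasEntryDerivAt (fun x => (G x)ᵀ) G'ᵀ b := fun i j => h j i
  exact h2.unique (h.congr_of_eventuallyEq hs)

theorem IsSmoothCurve.isSymm {ι : Type*} {B : Set ℝ} (hB : IsOpen B) {G G₁ G₂ : ℝ → Matrix ι ι ℝ}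
    (h : IsSmoothCurve B G G₁ G₂) {b : ℝ} (hb : b ∈ B) : (G₁ b).IsSymm :=
  (h.hasDeriv b hb).isSymm <| by
    filter_upwards [hB.mem_nhds hb] with x hx
    exact (Matrix.isHermitian_iff_isSymm.1 (h.posDef x hx).isHermitian)

/-- The derivative of `concentrated X` along a curve through `G` with velocity `G₁`. -/
noncomputable def concentratedScore (X : Matrix ι κ ℝ) (G G₁ : Matrix ι ι ℝ) : ℝ :=
  -(Fintype.card κ / 2) * (G⁻¹ * G₁).trace
    - Fintype.card ι / 2 * ((Xᵀ * G⁻¹ * X)⁻¹ * (Xᵀ * (-(G⁻¹ * G₁ * G⁻¹)) * X)).trace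

/-- The second derivative of `concentrated X` along a curve through `G` with velocity `G₁` and
acceleration `G₂`. -/
noncomputable def concentratedHess (X : Matrix ι κ ℝ) (G G₁ G₂ : Matrix ι ι ℝ) : ℝ :=
  -(Fintype.card κ / 2) * ((G⁻¹ * G₂).trace - (G⁻¹ * G₁ * (G⁻¹ * G₁)).trace)
    - Fintype.card ι / 2 * (((Xᵀ * G⁻¹ * X)⁻¹ * (Xᵀ * (-((-(G⁻¹ * G₁ * G⁻¹) * G₁ + G⁻¹ * G₂) * G⁻¹
        + G⁻¹ * G₁ * (-(G⁻¹ * G₁ * G⁻¹)))) * X)).trace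
      - ((Xᵀ * G⁻¹ * X)⁻¹ * (Xᵀ * (-(G⁻¹ * G₁ * G⁻¹)) * X)
          * ((Xᵀ * G⁻¹ * X)⁻¹ * (Xᵀ * (-(G⁻¹ * G₁ * G⁻¹)) * X))).trace)

omit [DecidableEq κ] in
theorem posDef_transpose_mul_mul {G : Matrix ι ι ℝ} (hG : G.PosDef) {X : Matrix ι κ ℝ}
    (hX : Function.Injective X.mulVec) : (Xᵀ * G⁻¹ * X).PosDef := by
  have := hG.inv.conjTranspose_mul_mul_same hX
  rwa [Matrix.conjTranspose_eq_transpose_of_trivial] at this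

variable {B : Set ℝ} {G G₁ G₂ : ℝ → Matrix ι ι ℝ} {X : Matrix ι κ ℝ}

theorem IsSmoothCurve.hasEntryDerivAt_inv (h : IsSmoothCurve B G G₁ G₂) {b : ℝ} (hb : b ∈ B) :
    HasEntryDerivAt (fun x => (G x)⁻¹) (-((G b)⁻¹ * G₁ b * (G b)⁻¹)) b :=
  (h.hasDeriv b hb).inv (h.posDef b hb).det_pos.ne'

theorem IsSmoothCurve.hasDerivAt_concentrated (h : IsSmoothCurve B G G₁ G₂)
    (hX : Function.Injective X.mulVec) {b : ℝ} (hb : b ∈ B) :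
    HasDerivAt (fun x => concentrated X (G x)) (concentratedScore X (G b) (G₁ b)) b :=
  (((h.hasDeriv b hb).log_det (h.posDef b hb).det_pos.ne').const_mul _).sub
    ((((h.hasEntryDerivAt_inv hb).const_mul_mul_const Xᵀ X).log_det
      (posDef_transpose_mul_mul (h.posDef b hb) hX).det_pos.ne').const_mul _)

theorem IsSmoothCurve.hasDerivAt_concentratedScore (h : IsSmoothCurve B G G₁ G₂)
    (hX : Function.Injective X.mulVec) {b : ℝ} (hb : b ∈ B) :
    HasDerivAt (fun x => concentratedScore X (G x) (G₁ x))
      (concentratedHess X (G b) (G₁ b) (G₂ b)) b := by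
  have hW := h.hasEntryDerivAt_inv hb
  have h1 := (h.hasDeriv b hb).trace_inv_mul (h.hasDeriv₂ b hb) (h.posDef b hb).det_pos.ne'
  have hW₁ := (((hW.mul (h.hasDeriv₂ b hb)).mul hW).neg).const_mul_mul_const Xᵀ X
  have h2 := HasEntryDerivAt.trace_inv_mul
    (M := fun x => Xᵀ * (G x)⁻¹ * X) (M₁ := fun x => Xᵀ * (-((G x)⁻¹ * G₁ x * (G x)⁻¹)) * X)
    (hW.const_mul_mul_const Xᵀ X) hW₁
    (posDef_transpose_mul_mul (h.posDef b hb) hX).det_pos.ne'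
  exact (h1.const_mul _).sub (h2.const_mul _)

/-! In the coordinates in which `G` is the identity, the score and the second derivative depend on
the data only through the projection onto the column space. -/

variable {K D E : Matrix ι ι ℝ}

omit [DecidableEq ι] in
theorem trace_inv_gram_mul (H : Matrix ι κ ℝ) (C : Matrix ι ι ℝ) :
    ((Hᵀ * H)⁻¹ * (Hᵀ * C * H)).trace = (hatMatrix H * C).trace := by
  rw [Matrix.trace_mul_comm, Matrix.mul_assoc, Matrix.mul_assoc, Matrix.trace_mul_comm,
    Matrix.mul_assoc, Matrix.trace_mul_comm, hatMatrix]

omit [DecidableEq ι] in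
theorem trace_inv_gram_mul_sq (H : Matrix ι κ ℝ) (C : Matrix ι ι ℝ) :
    ((Hᵀ * H)⁻¹ * (Hᵀ * C * H) * ((Hᵀ * H)⁻¹ * (Hᵀ * C * H))).trace =
      (hatMatrix H * C * (hatMatrix H * C)).trace := by
  have e : (Hᵀ * H)⁻¹ * (Hᵀ * C * H) * ((Hᵀ * H)⁻¹ * (Hᵀ * C * H)) =
      (Hᵀ * H)⁻¹ * (Hᵀ * (C * hatMatrix H * C) * H) := by
    simp only [hatMatrix, Matrix.mul_assoc]
  rw [e, trace_inv_gram_mul]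
  simp only [Matrix.mul_assoc]

theorem concentratedScore_eq {G : Matrix ι ι ℝ} (hK : G⁻¹ = Kᵀ * K) (X : Matrix ι κ ℝ) :
    concentratedScore X G D = Fintype.card ι / 2 * (hatMatrix (K * X) * (K * D * Kᵀ)).trace
      - Fintype.card κ / 2 * (K * D * Kᵀ).trace := by
  have e1 : (G⁻¹ * D).trace = (K * D * Kᵀ).trace := by
    rw [hK, Matrix.mul_assoc, Matrix.trace_mul_comm]
  have e2 : Xᵀ * G⁻¹ * X = (K * X)ᵀ * (K * X) := by
    simp only [hK, Matrix.transpose_mul, Matrix.mul_assoc]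
  have e3 : Xᵀ * (-(G⁻¹ * D * G⁻¹)) * X = (K * X)ᵀ * (-(K * D * Kᵀ)) * (K * X) := by
    simp only [hK, Matrix.transpose_mul, Matrix.mul_assoc, Matrix.mul_neg, Matrix.neg_mul]
  rw [concentratedScore, e1, e2, e3, trace_inv_gram_mul, Matrix.mul_neg, Matrix.trace_neg]
  ring

theorem concentratedHess_eq {G : Matrix ι ι ℝ} (hK : G⁻¹ = Kᵀ * K) (X : Matrix ι κ ℝ) :
    concentratedHess X G D E =
      -(Fintype.card κ / 2) * ((K * E * Kᵀ).trace - (K * D * Kᵀ * (K * D * Kᵀ)).trace)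
      - Fintype.card ι / 2 * (2 * (hatMatrix (K * X) * (K * D * Kᵀ * (K * D * Kᵀ))).trace
        - (hatMatrix (K * X) * (K * E * Kᵀ)).trace
        - (hatMatrix (K * X) * (K * D * Kᵀ) * (hatMatrix (K * X) * (K * D * Kᵀ))).trace) := by
  have e1 : (G⁻¹ * E).trace = (K * E * Kᵀ).trace := by
    rw [hK, Matrix.mul_assoc, Matrix.trace_mul_comm]
  have e1' : (G⁻¹ * D * (G⁻¹ * D)).trace = (K * D * Kᵀ * (K * D * Kᵀ)).trace := by
    have : G⁻¹ * D * (G⁻¹ * D) = Kᵀ * (K * D * Kᵀ * K * D) := by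
      simp only [hK, Matrix.mul_assoc]
    rw [this, Matrix.trace_mul_comm]
    simp only [Matrix.mul_assoc]
  have e2 : Xᵀ * G⁻¹ * X = (K * X)ᵀ * (K * X) := by
    simp only [hK, Matrix.transpose_mul, Matrix.mul_assoc]
  have e3 : Xᵀ * (-(G⁻¹ * D * G⁻¹)) * X = (K * X)ᵀ * (-(K * D * Kᵀ)) * (K * X) := by
    simp only [hK, Matrix.transpose_mul, Matrix.mul_assoc, Matrix.mul_neg, Matrix.neg_mul]
  have e4 : Xᵀ * (-((-(G⁻¹ * D * G⁻¹) * D + G⁻¹ * E) * G⁻¹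
        + G⁻¹ * D * (-(G⁻¹ * D * G⁻¹)))) * X =
      (K * X)ᵀ * ((2 : ℝ) • (K * D * Kᵀ * (K * D * Kᵀ)) - K * E * Kᵀ) * (K * X) := by
    simp only [hK, Matrix.transpose_mul, Matrix.mul_assoc, Matrix.mul_neg, Matrix.neg_mul,
      Matrix.add_mul, Matrix.mul_add, Matrix.mul_sub, Matrix.sub_mul, two_smul]
    abel
  rw [concentratedHess, e1, e1', e2, e3, e4, trace_inv_gram_mul, trace_inv_gram_mul_sq]
  simp only [Matrix.mul_neg, Matrix.neg_mul, neg_neg, Matrix.mul_sub, Matrix.trace_sub,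
    Matrix.mul_smul, Matrix.trace_smul, smul_eq_mul]

end Concentrated

/-! ### The second Bartlett identity for concentrated log likelihoods -/

section ProjectionScore

variable {Ω : Type*} [MeasurableSpace Ω] {μ : Measure Ω} [IsProbabilityMeasure μ] {ι : Type*}
  [Fintype ι] [DecidableEq ι]

/-- The score as a function of the random projection `P` of rank `k`. -/
noncomputable def projScore (k : ℝ) (A P : Matrix ι ι ℝ) : ℝ :=
  Fintype.card ι / 2 * (P * A).trace - k / 2 * A.trace

/-- The second derivative as a function of the random projection `P` of rank `k`. -/
noncomputable def projHess (k : ℝ) (A A₂ P : Matrix ι ι ℝ) : ℝ :=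
  -(k / 2) * (A₂.trace - (A * A).trace) - Fintype.card ι / 2 *
    (2 * (P * (A * A)).trace - (P * A₂).trace - (P * A * (P * A)).trace)

/-- The common value of the variance of `projScore` and the negative mean of `projHess`. -/
noncomputable def projInfo (k : ℝ) (A : Matrix ι ι ℝ) : ℝ :=
  (Fintype.card ι * (A * A).trace - A.trace ^ 2) *
    (k * (Fintype.card ι - k) / (2 * (Fintype.card ι - 1) * (Fintype.card ι + 2)))

omit [DecidableEq ι] in
theorem trace_sq_of_card_eq_one (h1 : Fintype.card ι = 1) (A : Matrix ι ι ℝ) :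
    (A * A).trace = A.trace ^ 2 := by
  obtain ⟨x, hx⟩ := Fintype.card_eq_one_iff.1 h1
  have : Unique ι := ⟨⟨x⟩, hx⟩
  simp [Matrix.trace, Matrix.mul_apply, sq]

namespace IsInvariantProjection

variable {P : Ω → Matrix ι ι ℝ} {k : ℝ}

omit [IsProbabilityMeasure μ] in
theorem measurable_projScore (h : IsInvariantProjection μ P k) (A : Matrix ι ι ℝ) :
    Measurable fun ω => projScore k A (P ω) :=
  ((h.measurable_trace_mul A).const_mul _).sub_const _

theorem memLp_projScore (h : IsInvariantProjection μ P k) (A : Matrix ι ι ℝ) :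
    MemLp (fun ω => projScore k A (P ω)) 2 μ :=
  ((h.memLp_trace_mul A 2).const_mul _).sub (memLp_const _)

theorem integrable_trace_mul (h : IsInvariantProjection μ P k) (A : Matrix ι ι ℝ) :
    Integrable (fun ω => (P ω * A).trace) μ :=
  memLp_one_iff_integrable.1 (h.memLp_trace_mul A 1)

theorem integrable_projHess (h : IsInvariantProjection μ P k) (A A₂ : Matrix ι ι ℝ) :
    Integrable (fun ω => projHess k A A₂ (P ω)) μ :=
  (integrable_const _).sub (((((h.integrable_trace_mul (A * A)).const_mul 2).sub
    (h.integrable_trace_mul A₂)).sub (h.integrable_trace_mul_mul_mul A)).const_mul _)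

theorem integral_projScore (h : IsInvariantProjection μ P k) (A : Matrix ι ι ℝ) :
    ∫ ω, projScore k A (P ω) ∂μ = 0 := by
  unfold projScore
  rw [integral_sub ((h.integrable_trace_mul A).const_mul _) (integrable_const _),
    integral_const_mul, integral_const, probReal_univ, one_smul]
  linear_combination h.card_mul_integral A / 2

/-- The score is uncorrelated with bounded functions that are invariant under the rotations of the
projection. -/
theorem integral_mul_projScore [Nonempty ι] (h : IsInvariantProjection μ P k) (A : Matrix ι ι ℝ)
    {g : Ω → ℝ} (hg : MemLp g 2 μ) (hgm : Measurable g)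
    (hinv : ∀ O : Matrix ι ι ℝ, O * Oᵀ = 1 → ∃ T : Ω → Ω, MeasurePreserving T μ μ ∧
      (∀ ω, P (T ω) = O * P ω * Oᵀ) ∧ ∀ ω, g (T ω) = g ω) :
    ∫ ω, g ω * projScore k A (P ω) ∂μ = 0 := by
  have e : ∀ ω, g ω * projScore k A (P ω) =
      Fintype.card ι / 2 * (g ω * (P ω * A).trace) - k / 2 * A.trace * g ω := fun ω => by
    unfold projScore; ring
  simp only [e]
  have i1 : Integrable (fun ω => g ω * (P ω * A).trace) μ :=
    hg.integrable_mul (h.memLp_trace_mul A 2)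
  rw [integral_sub (i1.const_mul _) ((hg.integrable (by norm_num)).const_mul _),
    integral_const_mul, integral_const_mul]
  linear_combination h.card_mul_integral_weight hg hgm hinv A / 2

omit [DecidableEq ι] in
/-- The constant `β` of the second moments of the projection determines the information. -/
theorem projInfo_eq [Nonempty ι] {α β : ℝ}
    (h₁ : α * Fintype.card ι ^ 2 + 2 * β * Fintype.card ι = k ^ 2)
    (h₂ : α * Fintype.card ι + β * (Fintype.card ι + Fintype.card ι ^ 2) = k)
    (A : Matrix ι ι ℝ) :
    projInfo k A = Fintype.card ι * β / 2 * (Fintype.card ι * (A * A).trace - A.trace ^ 2) := by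
  unfold projInfo
  have hc : 1 ≤ Fintype.card ι := Fintype.card_pos
  rcases hc.eq_or_lt with hc | hc
  · rw [trace_sq_of_card_eq_one hc.symm, ← hc]
    simp
  · have hN : (1 : ℝ) < Fintype.card ι := by exact_mod_cast hc
    have h3 : (Fintype.card ι - 1 : ℝ) ≠ 0 := by linarith
    have h4 : (Fintype.card ι + 2 : ℝ) ≠ 0 := by linarith
    have key : k * (Fintype.card ι - k) / (2 * (Fintype.card ι - 1) * (Fintype.card ι + 2)) =
        Fintype.card ι * β / 2 := by
      rw [div_eq_iff (by positivity)]
      linear_combination h₁ - Fintype.card ι * h₂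
    rw [key]
    ring

theorem integral_projScore_sq [Nonempty ι] (h : IsInvariantProjection μ P k) {A : Matrix ι ι ℝ}
    (hA : A.IsSymm) : ∫ ω, projScore k A (P ω) * projScore k A (P ω) ∂μ = projInfo k A := by
  obtain ⟨α, β, h₁, h₂, hm⟩ := h.integral_second_moments
  rw [projInfo_eq h₁ h₂]
  have e : ∀ ω, projScore k A (P ω) * projScore k A (P ω) =
      (Fintype.card ι / 2) ^ 2 * (P ω * A).trace ^ 2
      - (Fintype.card ι / 2 * k * A.trace * (P ω * A).trace - (k / 2 * A.trace) ^ 2) := fun ω => by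
    unfold projScore; ring
  simp only [e]
  have i1 : Integrable (fun ω => Fintype.card ι / 2 * k * A.trace * (P ω * A).trace
      - (k / 2 * A.trace) ^ 2) μ :=
    ((h.integrable_trace_mul A).const_mul _).sub (integrable_const _)
  rw [integral_sub ((h.memLp_trace_mul A 2).integrable_sq.const_mul _) i1,
    integral_sub ((h.integrable_trace_mul A).const_mul _) (integrable_const _),
    integral_const_mul, integral_const_mul, integral_const, probReal_univ, one_smul,
    (hm A hA).1]
  linear_combination (-(k / 2) * A.trace) * h.card_mul_integral A + A.trace ^ 2 / 4 * h₁

theorem integral_projHess [Nonempty ι] (h : IsInvariantProjection μ P k) {A : Matrix ι ι ℝ}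
    (hA : A.IsSymm) (A₂ : Matrix ι ι ℝ) :
    ∫ ω, projHess k A A₂ (P ω) ∂μ = -projInfo k A := by
  obtain ⟨α, β, h₁, h₂, hm⟩ := h.integral_second_moments
  rw [projInfo_eq h₁ h₂]
  unfold projHess
  have i1 := (h.integrable_trace_mul (A * A)).const_mul 2
  have i2 := h.integrable_trace_mul A₂
  have i3 := h.integrable_trace_mul_mul_mul A
  have i4 : Integrable (fun ω => 2 * (P ω * (A * A)).trace - (P ω * A₂).trace) μ := i1.sub i2
  have i5 : Integrable (fun ω => 2 * (P ω * (A * A)).trace - (P ω * A₂).trace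
      - (P ω * A * (P ω * A)).trace) μ := i4.sub i3
  rw [integral_sub (integrable_const _) (i5.const_mul _), integral_const,
    probReal_univ, one_smul, integral_const_mul, integral_sub i4 i3, integral_sub i1 i2,
    integral_const_mul, (hm A hA).2]
  linear_combination -(h.card_mul_integral (A * A)) + h.card_mul_integral A₂ / 2
    + (A * A).trace / 2 * h₂

end IsInvariantProjection

end ProjectionScore

section Bartlett

open scoped MatrixOrder in
theorem exists_inv_eq_transpose_mul_self {ι : Type*} [Fintype ι] [DecidableEq ι]
    {G : Matrix ι ι ℝ} (hG : G.PosDef) :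
    ∃ K : Matrix ι ι ℝ, G⁻¹ = Kᵀ * K ∧ K.det ≠ 0 := by
  obtain ⟨K, hK⟩ := CStarAlgebra.nonneg_iff_eq_star_mul_self.1 hG.inv.posSemidef.nonneg
  rw [Matrix.star_eq_conjTranspose, Matrix.conjTranspose_eq_transpose_of_trivial] at hK
  refine ⟨K, hK, fun h => hG.inv.det_pos.ne' ?_⟩
  rw [hK, Matrix.det_mul, h, mul_zero]

variable {n k : ℕ} {ι κ J : Type*} [Fintype ι] [DecidableEq ι] [Nonempty ι]
  [Fintype κ] [DecidableEq κ] [Fintype J]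

/-- If the profile log likelihood is a sum of concentrated log likelihoods of blocks `X r` of the
data, and rotations can be applied to each of the blocks separately, then the second Bartlett
identity holds. -/
theorem bartlettTwo_of_concentrated {M : Set (Matrix (Fin k) (Fin k) ℝ)} {B : Set ℝ}
    (hB : IsOpen B) {Γ : ℝ → Matrix (Fin n) (Fin n) ℝ} {β : ℝ} (hβ : β ∈ B)
    {S : Matrix (Fin k) (Fin k) ℝ} {G G₁ G₂ : ℝ → Matrix ι ι ℝ} (hG : IsSmoothCurve B G G₁ G₂)
    (X : J → Matrix (Fin n) (Fin k) ℝ → Matrix ι κ ℝ)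
    (hXm : ∀ r i a, Measurable fun Y => X r Y i a)
    (hinj : ∀ᵐ Y ∂(law (Γ β) S), ∀ r, Function.Injective (X r Y).mulVec) (c : ℝ)
    (hprof : ∀ᵐ Y ∂(law (Γ β) S), ∀ b ∈ B,
      profileLogLik M (Γ b) Y = ((c + ∑ r, concentrated (X r Y) (G b) : ℝ) : EReal))
    (hrot : ∀ L : Matrix ι ι ℝ, L * G β * Lᵀ = G β → ∀ r,
      ∃ T, MeasurePreserving T (law (Γ β) S) (law (Γ β) S) ∧
        ∀ Y, X r (T Y) = L * X r Y ∧ ∀ s, s ≠ r → X s (T Y) = X s Y) {v : ℝ}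
    (hv : v = Fintype.card J * ((Fintype.card ι * ((G β)⁻¹ * G₁ β * ((G β)⁻¹ * G₁ β)).trace
      - ((G β)⁻¹ * G₁ β).trace ^ 2) * (Fintype.card κ * (Fintype.card ι - Fintype.card κ) /
        (2 * (Fintype.card ι - 1) * (Fintype.card ι + 2))))) :
    BartlettTwo M B Γ β S v := by
  obtain ⟨K, hK, hKdet⟩ := exists_inv_eq_transpose_mul_self (hG.posDef β hβ)
  have hKu := isUnit_iff_ne_zero.2 hKdet
  have hGu := isUnit_iff_ne_zero.2 (hG.posDef β hβ).det_pos.ne'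
  have hGK : K * G β * Kᵀ = 1 := by
    have : K * (G β * (G β)⁻¹) * K⁻¹ = 1 := by
      rw [Matrix.mul_nonsing_inv _ hGu, Matrix.mul_one, Matrix.mul_nonsing_inv _ hKu]
    rw [hK] at this
    calc K * G β * Kᵀ = K * (G β * (Kᵀ * K)) * K⁻¹ := by
          simp only [Matrix.mul_assoc, Matrix.mul_nonsing_inv _ hKu, Matrix.mul_one]
      _ = 1 := this
  have hd₁ : ∀ᵐ Y ∂(law (Γ β) S), ∀ b ∈ B, HasDerivAt (profileCurve M Γ Y)
      (∑ r, concentratedScore (X r Y) (G b) (G₁ b)) b := by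
    filter_upwards [hinj, hprof] with Y hY hp b hb
    have h1 : HasDerivAt (fun x => c + ∑ r, concentrated (X r Y) (G x))
        (∑ r, concentratedScore (X r Y) (G b) (G₁ b)) b :=
      (HasDerivAt.fun_sum fun r _ => hG.hasDerivAt_concentrated (hY r) hb).const_add c
    refine h1.congr_of_eventuallyEq ?_
    filter_upwards [hB.mem_nhds hb] with x hx
    rw [profileCurve, hp x hx, EReal.toReal_coe]
  have hd₂ : ∀ᵐ Y ∂(law (Γ β) S), ∀ b ∈ B, HasDerivAt (deriv (profileCurve M Γ Y))
      (∑ r, concentratedHess (X r Y) (G b) (G₁ b) (G₂ b)) b := by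
    filter_upwards [hinj, hd₁] with Y hY hp b hb
    have h1 : HasDerivAt (fun x => ∑ r, concentratedScore (X r Y) (G x) (G₁ x))
        (∑ r, concentratedHess (X r Y) (G b) (G₁ b) (G₂ b)) b :=
      HasDerivAt.fun_sum fun r _ => hG.hasDerivAt_concentratedScore (hY r) hb
    refine h1.congr_of_eventuallyEq ?_
    filter_upwards [hB.mem_nhds hb] with x hx
    exact (hp x hx).deriv
  set A := K * G₁ β * Kᵀ with hA
  set A₂ := K * G₂ β * Kᵀ with hA₂
  have hAs : A.IsSymm := by
    rw [Matrix.IsSymm, hA, Matrix.transpose_mul, Matrix.transpose_mul, Matrix.transpose_transpose,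
      (hG.isSymm hB hβ).eq, Matrix.mul_assoc]
  let P : J → Matrix (Fin n) (Fin k) ℝ → Matrix ι ι ℝ := fun r Y => hatMatrix (K * X r Y)
  -- conjugation with `K` turns an orthogonal map into one that fixes `G β`
  have hrot' : ∀ O : Matrix ι ι ℝ, O * Oᵀ = 1 → ∀ r,
      ∃ T, MeasurePreserving T (law (Γ β) S) (law (Γ β) S) ∧
        ∀ Y, K * X r (T Y) = O * (K * X r Y) ∧ ∀ s, s ≠ r → X s (T Y) = X s Y := by
    intro O hO r
    have hL : K⁻¹ * O * K * G β * (K⁻¹ * O * K)ᵀ = G β := by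
      have e1 : K⁻¹ * O * K * G β * (K⁻¹ * O * K)ᵀ =
          K⁻¹ * (O * (K * G β * Kᵀ) * Oᵀ) * K⁻¹ᵀ := by
        simp only [Matrix.transpose_mul, Matrix.mul_assoc]
      have e2 : G β = (Kᵀ * K)⁻¹ := by rw [← hK, Matrix.nonsing_inv_nonsing_inv _ hGu]
      rw [e1, hGK, Matrix.mul_one, hO, Matrix.mul_one, e2, Matrix.mul_inv_rev,
        Matrix.transpose_nonsing_inv]
    obtain ⟨T, hT, hTX⟩ := hrot _ hL r
    refine ⟨T, hT, fun Y => ⟨?_, (hTX Y).2⟩⟩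
    rw [(hTX Y).1]
    simp only [Matrix.mul_assoc, Matrix.mul_nonsing_inv_cancel_left _ _ hKu]
  have hP : ∀ r, IsInvariantProjection (law (Γ β) S) (P r) (Fintype.card κ) := by
    intro r
    refine isInvariantProjection_hatMatrix
      (fun i j => measurable_mul_entry (F := fun _ => K) (fun _ _ => measurable_const) (hXm r) i j) ?_ ?_
    · filter_upwards [hinj] with Y hY
      have := (posDef_transpose_mul_mul (hG.posDef β hβ) (hY r)).det_pos.ne'
      rwa [hK, ← Matrix.mul_assoc, Matrix.mul_assoc, ← Matrix.transpose_mul] at this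
    · intro O hO
      obtain ⟨T, hT, h⟩ := hrot' O hO r
      exact ⟨T, hT, fun Y => (h Y).1⟩
  have hscore : score M Γ β =ᵐ[law (Γ β) S]
      fun Y => ∑ r, projScore (Fintype.card κ) A (P r Y) := by
    filter_upwards [hd₁] with Y hY
    rw [score, (hY β hβ).deriv]
    exact Finset.sum_congr rfl fun r _ => concentratedScore_eq hK _
  have hhess : secondDeriv M Γ β =ᵐ[law (Γ β) S]
      fun Y => ∑ r, projHess (Fintype.card κ) A A₂ (P r Y) := by
    filter_upwards [hd₂] with Y hY
    rw [secondDeriv, (hY β hβ).deriv]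
    exact Finset.sum_congr rfl fun r _ => concentratedHess_eq hK _
  have hv' : v = Fintype.card J * projInfo (Fintype.card κ) A := by
    have e1 : ((G β)⁻¹ * G₁ β).trace = A.trace := by
      rw [hK, Matrix.mul_assoc, Matrix.trace_mul_comm]
    have e2 : ((G β)⁻¹ * G₁ β * ((G β)⁻¹ * G₁ β)).trace = (A * A).trace := by
      have : (G β)⁻¹ * G₁ β * ((G β)⁻¹ * G₁ β) = Kᵀ * (A * K * G₁ β) := by
        simp only [hK, hA, Matrix.mul_assoc]
      rw [this, Matrix.trace_mul_comm]
      simp only [hA, Matrix.mul_assoc]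
    rw [hv, e1, e2, projInfo]
  have hmem : MemLp (fun Y => ∑ r, projScore (Fintype.card κ) A (P r Y)) 2 (law (Γ β) S) :=
    memLp_finsetSum _ fun r _ => (hP r).memLp_projScore A
  -- rotating block `s` alone shows that the scores of different blocks are uncorrelated
  have hcross : ∀ r s, r ≠ s → ∫ Y, projScore (Fintype.card κ) A (P r Y) *
      projScore (Fintype.card κ) A (P s Y) ∂(law (Γ β) S) = 0 := by
    intro r s hrs
    refine (hP s).integral_mul_projScore A ((hP r).memLp_projScore A)
      ((hP r).measurable_projScore A) fun O hO => ?_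
    obtain ⟨T, hT, h⟩ := hrot' O hO s
    refine ⟨T, hT, fun Y => ?_, fun Y => ?_⟩
    · change hatMatrix _ = _
      rw [(h Y).1, hatMatrix_mul hO]
    · change projScore _ _ (hatMatrix _) = _
      rw [(h Y).2 r hrs]
  refine ⟨?_, ?_, hmem.ae_eq hscore.symm, ?_, ?_, ?_⟩
  · filter_upwards [hprof] with Y hY b hb
    rw [hY b hb]
    exact ⟨EReal.coe_ne_top _, EReal.coe_ne_bot _⟩
  · filter_upwards [hd₁, hd₂] with Y h1 h2
    exact ⟨fun b hb => (h1 b hb).differentiableAt.differentiableWithinAt,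
      fun b hb => (h2 b hb).differentiableAt.differentiableWithinAt⟩
  · refine Integrable.congr ?_ hhess.symm
    exact integrable_finsetSum _ fun r _ => (hP r).integrable_projHess A A₂
  · have hmean : ∫ Y, ∑ r, projScore (Fintype.card κ) A (P r Y) ∂(law (Γ β) S) = 0 := by
      rw [integral_finsetSum _ fun r _ => ((hP r).memLp_projScore A).integrable (by norm_num)]
      exact Finset.sum_eq_zero fun r _ => (hP r).integral_projScore A
    rw [fisherInfo, variance_congr hscore, variance_of_integral_eq_zero hmem.aemeasurable hmean,
      hv']
    have hI : ∀ r s, Integrable (fun Y => projScore (Fintype.card κ) A (P r Y) *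
        projScore (Fintype.card κ) A (P s Y)) (law (Γ β) S) := fun r s =>
      ((hP r).memLp_projScore A).integrable_mul ((hP s).memLp_projScore A)
    simp only [sq, Finset.sum_mul_sum]
    rw [integral_finsetSum _ fun r _ => integrable_finsetSum _ fun s _ => hI r s]
    have : ∀ r, ∫ Y, ∑ s, projScore (Fintype.card κ) A (P r Y) *
        projScore (Fintype.card κ) A (P s Y) ∂(law (Γ β) S) = projInfo (Fintype.card κ) A := by
      intro r
      rw [integral_finsetSum _ fun s _ => hI r s,
        Finset.sum_eq_single r (fun s _ hs => hcross r s hs.symm)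
          (fun h => (h (Finset.mem_univ r)).elim)]
      exact (hP r).integral_projScore_sq hAs
    simp only [this, Finset.sum_const, Finset.card_univ, nsmul_eq_mul]
  · rw [integral_congr_ae hhess,
      integral_finsetSum _ fun r _ => (hP r).integrable_projHess A A₂, hv']
    simp only [(hP _).integral_projHess hAs, Finset.sum_const, Finset.card_univ, nsmul_eq_mul]
    ring

end Bartlett

/-! ### Maximisation over the column covariance matrix -/

section Profile

/-- The Gaussian log likelihood of a covariance matrix, given the sample covariance `T`, is
maximal at `T`. -/
theorem log_det_add_card_le {κ : Type*} [Fintype κ] [DecidableEq κ] {S T : Matrix κ κ ℝ}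
    (hS : S.PosDef) (hT : T.PosDef) :
    Real.log T.det + Fintype.card κ ≤ Real.log S.det + (T * S⁻¹).trace := by
  obtain ⟨K, hK, hKdet⟩ := exists_inv_eq_transpose_mul_self hS
  have hN : (K * T * Kᵀ).PosDef := by
    have := hT.mul_mul_conjTranspose_same (B := K)
      (Matrix.vecMul_injective_iff_isUnit.2 ((Matrix.isUnit_iff_isUnit_det _).2
        (isUnit_iff_ne_zero.2 hKdet)))
    rwa [Matrix.conjTranspose_eq_transpose_of_trivial] at this
  have htr : (T * S⁻¹).trace = (K * T * Kᵀ).trace := by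
    rw [hK, ← Matrix.mul_assoc, Matrix.trace_mul_comm, Matrix.mul_assoc]
  have hdet : Real.log (K * T * Kᵀ).det = Real.log T.det - Real.log S.det := by
    have h1 : (K * T * Kᵀ).det = T.det * (S.det)⁻¹ := by
      have h2 : S⁻¹.det = Kᵀ.det * K.det := by rw [hK, Matrix.det_mul]
      rw [Matrix.det_nonsing_inv, Ring.inverse_eq_inv'] at h2
      rw [h2, Matrix.det_mul, Matrix.det_mul]
      ring
    rw [h1, Real.log_mul hT.det_pos.ne' (inv_ne_zero hS.det_pos.ne'), Real.log_inv]
    ring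
  have hev : Real.log (K * T * Kᵀ).det ≤ (K * T * Kᵀ).trace - Fintype.card κ := by
    rw [hN.isHermitian.det_eq_prod_eigenvalues, hN.isHermitian.trace_eq_sum_eigenvalues]
    simp only [RCLike.ofReal_real_eq_id, id_eq]
    rw [Real.log_prod fun i _ => (hN.eigenvalues_pos i).ne']
    calc ∑ i, Real.log (hN.isHermitian.eigenvalues i)
        ≤ ∑ i, (hN.isHermitian.eigenvalues i - 1) :=
          Finset.sum_le_sum fun i _ => Real.log_le_sub_one_of_pos (hN.eigenvalues_pos i)
      _ = _ := by simp
  rw [htr]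
  linarith

variable {n k : ℕ}

theorem log_det_kronecker {Γ : Matrix (Fin n) (Fin n) ℝ} {S : Matrix (Fin k) (Fin k) ℝ}
    (hΓ : Γ.PosDef) (hS : S.PosDef) :
    Real.log (Γ ⊗ₖ S).det = k * Real.log Γ.det + n * Real.log S.det := by
  rw [Matrix.det_kronecker, Real.log_mul (pow_ne_zero _ hΓ.det_pos.ne')
    (pow_ne_zero _ hS.det_pos.ne'), Real.log_pow, Real.log_pow, Fintype.card_fin, Fintype.card_fin]

/-- The profile log likelihood when the model contains the maximiser `T`. -/
theorem profileLogLik_eq_of_maximizer {M : Set (Matrix (Fin k) (Fin k) ℝ)}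
    (hM : ∀ S ∈ M, S.PosDef) {Γ : Matrix (Fin n) (Fin n) ℝ} (hΓ : Γ.PosDef)
    {Y : Matrix (Fin n) (Fin k) ℝ} {T : Matrix (Fin k) (Fin k) ℝ} (hT : T ∈ M)
    (htr : ∀ S ∈ M, (Yᵀ * Γ⁻¹ * Y * S⁻¹).trace = n * (T * S⁻¹).trace) :
    profileLogLik M Γ Y =
      ((-(1 / 2) * (k * Real.log Γ.det + n * Real.log T.det) - n * k / 2 : ℝ) : EReal) := by
  unfold profileLogLik
  apply le_antisymm
  · refine iSup₂_le fun S hS => EReal.coe_le_coe_iff.2 ?_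
    rw [logLik, htr S hS, log_det_kronecker hΓ (hM S hS)]
    have h := log_det_add_card_le (hM S hS) (hM T hT)
    rw [Fintype.card_fin] at h
    nlinarith [mul_le_mul_of_nonneg_left h (Nat.cast_nonneg (α := ℝ) n)]
  · refine le_iSup₂_of_le T hT (EReal.coe_le_coe_iff.2 (le_of_eq ?_))
    rw [logLik, htr T hT, log_det_kronecker hΓ (hM T hT),
      Matrix.mul_nonsing_inv _ (isUnit_iff_ne_zero.2 (hM T hT).det_pos.ne'), Matrix.trace_one,
      Fintype.card_fin]
    ring

theorem posDef_of_mem_modelI {S : Matrix (Fin k) (Fin k) ℝ} (hS : S ∈ modelI k) : S.PosDef := by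
  obtain ⟨σ, hσ, rfl⟩ := hS
  exact Matrix.PosDef.one.smul (by positivity)

theorem posDef_of_mem_modelII {S : Matrix (Fin k) (Fin k) ℝ} (hS : S ∈ modelII k) :
    S.PosDef := by
  obtain ⟨σ, hσ, rfl⟩ := hS
  exact Matrix.PosDef.diagonal fun r => by have := hσ r; positivity

/-- Column `r` of `Y`, as a matrix with one column. -/
def column (r : Fin k) (Y : Matrix (Fin n) (Fin k) ℝ) : Matrix (Fin n) Unit ℝ :=
  Matrix.of fun i _ => Y i r

/-- All entries of `Y`, as a matrix with one column. -/
def vectorize (Y : Matrix (Fin n) (Fin k) ℝ) : Matrix (Fin n × Fin k) Unit ℝ :=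
  Matrix.of fun p _ => Y p.1 p.2

theorem det_column (Y : Matrix (Fin n) (Fin k) ℝ) (W : Matrix (Fin n) (Fin n) ℝ) (r : Fin k) :
    ((column r Y)ᵀ * W * column r Y).det = (Yᵀ * W * Y) r r := by
  rw [Matrix.det_unique]
  rfl

theorem det_vectorize (Y : Matrix (Fin n) (Fin k) ℝ) {Γ : Matrix (Fin n) (Fin n) ℝ} :
    ((vectorize Y)ᵀ * (Γ ⊗ₖ (1 : Matrix (Fin k) (Fin k) ℝ))⁻¹ * vectorize Y).det =
      (Yᵀ * Γ⁻¹ * Y).trace := by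
  rw [Matrix.inv_kronecker, inv_one, Matrix.det_unique]
  simp only [Matrix.trace, Matrix.diag_apply, Matrix.mul_apply, vectorize, Matrix.transpose_apply,
    Matrix.of_apply, Fintype.sum_prod_type, Matrix.kroneckerMap_apply, Matrix.one_apply, mul_ite,
    mul_one, mul_zero, Finset.sum_ite_eq', Finset.mem_univ, if_true]
  rw [Finset.sum_comm]

theorem profileLogLik_modelIII_eq {Γ : Matrix (Fin n) (Fin n) ℝ} (hn : 1 ≤ n) (hΓ : Γ.PosDef)
    {Y : Matrix (Fin n) (Fin k) ℝ} (hY : Function.Injective Y.mulVec) :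
    profileLogLik (modelIII k) Γ Y =
      ((n * k / 2 * Real.log n - n * k / 2 + concentrated Y Γ : ℝ) : EReal) := by
  have hn0 : (0 : ℝ) < n := by exact_mod_cast hn
  have hQ := posDef_transpose_mul_mul hΓ hY
  rw [profileLogLik_eq_of_maximizer (M := modelIII k) (T := (n : ℝ)⁻¹ • (Yᵀ * Γ⁻¹ * Y)) (fun S hS => hS) hΓ
    (hQ.smul (inv_pos.2 hn0))
    (fun S _ => by
      rw [Matrix.smul_mul, Matrix.trace_smul, smul_eq_mul, mul_inv_cancel_left₀ hn0.ne']),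
    Matrix.det_smul, Real.log_mul (pow_ne_zero _ (inv_ne_zero hn0.ne')) hQ.det_pos.ne',
    Real.log_pow, Real.log_inv, concentrated, Fintype.card_fin, Fintype.card_fin]
  congr 1
  ring

theorem profileLogLik_modelII_eq {Γ : Matrix (Fin n) (Fin n) ℝ} (hn : 1 ≤ n) (hΓ : Γ.PosDef)
    {Y : Matrix (Fin n) (Fin k) ℝ} (hY : ∀ r, Function.Injective (column r Y).mulVec) :
    profileLogLik (modelII k) Γ Y =
      ((n * k / 2 * Real.log n - n * k / 2 + ∑ r, concentrated (column r Y) Γ : ℝ) : EReal) := by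
  have hn0 : (0 : ℝ) < n := by exact_mod_cast hn
  have hq : ∀ r, 0 < (Yᵀ * Γ⁻¹ * Y) r r := fun r => by
    rw [← det_column]
    exact (posDef_transpose_mul_mul hΓ (hY r)).det_pos
  have hT : Matrix.diagonal (fun r => (Yᵀ * Γ⁻¹ * Y) r r / n) ∈ modelII k := by
    refine ⟨fun r => √((Yᵀ * Γ⁻¹ * Y) r r / n),
      fun r => Real.sqrt_pos.2 (div_pos (hq r) hn0), ?_⟩
    congr 1
    ext r
    rw [Real.sq_sqrt (div_pos (hq r) hn0).le]
  rw [profileLogLik_eq_of_maximizer (fun S hS => posDef_of_mem_modelII hS) hΓ hT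
    (fun S hS => by
      obtain ⟨σ, hσ, rfl⟩ := hS
      have hinv : (Matrix.diagonal fun r => σ r ^ 2)⁻¹ = Matrix.diagonal fun r => (σ r ^ 2)⁻¹ := by
        refine Matrix.inv_eq_right_inv ?_
        rw [Matrix.diagonal_mul_diagonal, ← Matrix.diagonal_one]
        congr 1
        ext r
        exact mul_inv_cancel₀ (pow_ne_zero _ (hσ r).ne')
      rw [hinv, Matrix.diagonal_mul_diagonal, Matrix.trace_diagonal, Finset.mul_sum]
      simp only [Matrix.trace, Matrix.diag_apply, Matrix.mul_diagonal]
      refine Finset.sum_congr rfl fun r _ => ?_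
      field_simp),
    Matrix.det_diagonal, Real.log_prod fun r _ => (div_pos (hq r) hn0).ne']
  congr 1
  simp only [concentrated, det_column, Fintype.card_unit, Fintype.card_fin]
  simp only [Real.log_div (hq _).ne' hn0.ne', Finset.sum_sub_distrib, Finset.sum_const,
    Finset.card_univ, Fintype.card_fin, nsmul_eq_mul, ← Finset.mul_sum]
  push_cast
  ring

theorem profileLogLik_modelI_eq {Γ : Matrix (Fin n) (Fin n) ℝ} (hn : 1 ≤ n) (hk : 1 ≤ k)
    (hΓ : Γ.PosDef) {Y : Matrix (Fin n) (Fin k) ℝ}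
    (hY : Function.Injective (vectorize Y).mulVec) :
    profileLogLik (modelI k) Γ Y =
      ((n * k / 2 * Real.log (n * k) - n * k / 2 +
        concentrated (vectorize Y) (Γ ⊗ₖ (1 : Matrix (Fin k) (Fin k) ℝ)) : ℝ) : EReal) := by
  have hn0 : (0 : ℝ) < n := by exact_mod_cast hn
  have hk0 : (0 : ℝ) < k := by exact_mod_cast hk
  have hq : 0 < (Yᵀ * Γ⁻¹ * Y).trace := by
    rw [← det_vectorize]
    exact (posDef_transpose_mul_mul (hΓ.kronecker Matrix.PosDef.one) hY).det_pos
  have hq' : 0 < (Yᵀ * Γ⁻¹ * Y).trace / (n * k) := div_pos hq (mul_pos hn0 hk0)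
  have hT : ((Yᵀ * Γ⁻¹ * Y).trace / (n * k)) • (1 : Matrix (Fin k) (Fin k) ℝ) ∈ modelI k :=
    ⟨√((Yᵀ * Γ⁻¹ * Y).trace / (n * k)), Real.sqrt_pos.2 hq', by rw [Real.sq_sqrt hq'.le]⟩
  rw [profileLogLik_eq_of_maximizer (fun S hS => posDef_of_mem_modelI hS) hΓ hT
    (fun S hS => by
      obtain ⟨σ, hσ, rfl⟩ := hS
      have hinv : (σ ^ 2 • (1 : Matrix (Fin k) (Fin k) ℝ))⁻¹ = (σ ^ 2)⁻¹ • 1 := by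
        refine Matrix.inv_eq_right_inv ?_
        rw [Matrix.smul_mul, Matrix.mul_smul, Matrix.one_mul, smul_smul,
          mul_inv_cancel₀ (pow_ne_zero _ hσ.ne'), one_smul]
      rw [hinv]
      simp only [Matrix.mul_smul, Matrix.mul_one, Matrix.trace_smul, smul_eq_mul,
        Matrix.trace_one, Fintype.card_fin]
      field_simp),
    Matrix.det_smul, Matrix.det_one, mul_one, Real.log_pow]
  congr 1
  rw [concentrated, det_vectorize, log_det_kronecker hΓ Matrix.PosDef.one,
    Real.log_div hq.ne' (mul_pos hn0 hk0).ne']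
  simp only [Fintype.card_unit, Fintype.card_fin, Fintype.card_prod, Matrix.det_one, Real.log_one]
  push_cast
  ring

end Profile

/-! ### The three models -/

section Models

variable {n k : ℕ}

theorem injective_mulVec_of_det_submatrix_ne_zero {ι κ : Type*} [Fintype κ] [DecidableEq κ]
    {X : Matrix ι κ ℝ} {e : κ → ι} (h : (X.submatrix e id).det ≠ 0) :
    Function.Injective X.mulVec := by
  have h1 : Function.Injective (X.submatrix e id).mulVec :=
    Matrix.mulVec_injective_iff_isUnit.2
      ((Matrix.isUnit_iff_isUnit_det _).2 (isUnit_iff_ne_zero.2 h))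
  exact fun v w hvw => h1 (funext fun i => congrFun hvw (e i))

theorem isSmoothCurve_of_differentiableOn {B : Set ℝ} (hB : IsOpen B)
    {Γ : ℝ → Matrix (Fin n) (Fin n) ℝ} (hpos : ∀ b ∈ B, (Γ b).PosDef)
    (hdiff : ∀ i j, DifferentiableOn ℝ (fun b => Γ b i j) B)
    (hdiff2 : ∀ i j, DifferentiableOn ℝ (deriv fun b => Γ b i j) B) :
    IsSmoothCurve B Γ (derivMatrix Γ)
      (fun b => Matrix.of fun i j => deriv (deriv fun b => Γ b i j) b) where
  posDef := hpos
  hasDeriv _ hb i j := ((hdiff i j).differentiableAt (hB.mem_nhds hb)).hasDerivAt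
  hasDeriv₂ _ hb i j := ((hdiff2 i j).differentiableAt (hB.mem_nhds hb)).hasDerivAt

theorem IsSmoothCurve.kronecker_one {B : Set ℝ} {Γ Γ₁ Γ₂ : ℝ → Matrix (Fin n) (Fin n) ℝ}
    (h : IsSmoothCurve B Γ Γ₁ Γ₂) :
    IsSmoothCurve B (fun b => Γ b ⊗ₖ (1 : Matrix (Fin k) (Fin k) ℝ))
      (fun b => Γ₁ b ⊗ₖ (1 : Matrix (Fin k) (Fin k) ℝ))
      (fun b => Γ₂ b ⊗ₖ (1 : Matrix (Fin k) (Fin k) ℝ)) where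
  posDef b hb := (h.posDef b hb).kronecker Matrix.PosDef.one
  hasDeriv b hb i j := (h.hasDeriv b hb i.1 j.1).mul_const _
  hasDeriv₂ b hb i j := (h.hasDeriv₂ b hb i.1 j.1).mul_const _

theorem vecAct_kronecker_one (L : Matrix (Fin n) (Fin n) ℝ) (Y : Matrix (Fin n) (Fin k) ℝ) :
    vecAct (L ⊗ₖ (1 : Matrix (Fin k) (Fin k) ℝ)) Y = L * Y := by
  ext i r
  simp [vecAct, Matrix.mulVec, dotProduct, Fintype.sum_prod_type, Matrix.kroneckerMap_apply,
    Matrix.one_apply, Matrix.mul_apply]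

theorem V_eq (Γ : ℝ → Matrix (Fin n) (Fin n) ℝ) (β : ℝ) :
    V Γ β = n * ((Γ β)⁻¹ * derivMatrix Γ β * ((Γ β)⁻¹ * derivMatrix Γ β)).trace
      - ((Γ β)⁻¹ * derivMatrix Γ β).trace ^ 2 := by
  rw [V]
  simp only [Matrix.mul_assoc]

variable {B : Set ℝ} {Γ : ℝ → Matrix (Fin n) (Fin n) ℝ} {β : ℝ} {S : Matrix (Fin k) (Fin k) ℝ}

/-- For Model III the factor `n - 1` of the denominator may vanish; then `n = k = 1` and the
numerator vanishes, too. -/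
theorem bartlettTwo_modelIII (hn : 1 ≤ n) (hk : k ≤ n) (hB : IsOpen B)
    {Γ₂ : ℝ → Matrix (Fin n) (Fin n) ℝ} (hΓ : IsSmoothCurve B Γ (derivMatrix Γ) Γ₂) (hβ : β ∈ B)
    (hS : S ∈ modelIII k) :
    BartlettTwo (modelIII k) B Γ β S
      (V Γ β * ((k : ℝ) * ((n : ℝ) - k) / (2 * ((n : ℝ) - 1) * ((n : ℝ) + 2)))) := by
  have : Nonempty (Fin n) := ⟨⟨0, hn⟩⟩
  have hS' : S.PosDef := hS
  have hinj : ∀ᵐ Y ∂(law (Γ β) S), Function.Injective Y.mulVec := by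
    filter_upwards [ae_det_submatrix_ne_zero (hΓ.posDef β hβ) hS' (Fin.castLE_injective hk)
      Function.injective_id] with Y hY
    exact injective_mulVec_of_det_submatrix_ne_zero hY
  refine bartlettTwo_of_concentrated hB hβ hΓ (fun (_ : Unit) Y => Y)
    (fun _ i a => measurable_entry i a) (hinj.mono fun Y hY _ => hY)
    (n * k / 2 * Real.log n - n * k / 2) ?_ ?_ ?_
  · filter_upwards [hinj] with Y hY b hb
    rw [profileLogLik_modelIII_eq hn (hΓ.posDef b hb) hY, Fintype.sum_unique]
  · intro L hL r
    refine ⟨_, measurePreserving_vecAct (M := L ⊗ₖ (1 : Matrix (Fin k) (Fin k) ℝ))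
      (hΓ.posDef β hβ) hS' ?_, fun Y => ⟨vecAct_kronecker_one L Y, fun s hs => (hs rfl).elim⟩⟩
    rw [← Matrix.mul_kronecker_mul, ← Matrix.kroneckerMap_transpose, ← Matrix.mul_kronecker_mul,
      hL, Matrix.transpose_one, Matrix.one_mul, Matrix.mul_one]
  · rw [V_eq, Fintype.card_fin, Fintype.card_fin, Fintype.card_unit, Nat.cast_one, one_mul]

/-- Model II is the sum of `k` independent models with one series. -/
theorem bartlettTwo_modelII (hn : 1 ≤ n) (hB : IsOpen B)
    {Γ₂ : ℝ → Matrix (Fin n) (Fin n) ℝ} (hΓ : IsSmoothCurve B Γ (derivMatrix Γ) Γ₂) (hβ : β ∈ B)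
    (hS : S ∈ modelII k) :
    BartlettTwo (modelII k) B Γ β S (V Γ β * ((k : ℝ) / (2 * ((n : ℝ) + 2)))) := by
  have : Nonempty (Fin n) := ⟨⟨0, hn⟩⟩
  have hS' := posDef_of_mem_modelII hS
  have hinj : ∀ᵐ Y ∂(law (Γ β) S), ∀ r, Function.Injective (column r Y).mulVec := by
    refine ae_all_iff.2 fun r => ?_
    filter_upwards [ae_det_submatrix_ne_zero (hΓ.posDef β hβ) hS' (κ := Unit)
      (e := fun _ => ⟨0, hn⟩) (f := fun _ => r) (Function.injective_of_subsingleton _)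
      (Function.injective_of_subsingleton _)] with Y hY
    exact injective_mulVec_of_det_submatrix_ne_zero (e := fun _ => ⟨0, hn⟩) hY
  refine bartlettTwo_of_concentrated hB hβ hΓ column
    (fun r i _ => measurable_entry i r) hinj
    (n * k / 2 * Real.log n - n * k / 2) ?_ ?_ ?_
  · filter_upwards [hinj] with Y hY b hb
    exact profileLogLik_modelII_eq hn (hΓ.posDef b hb) hY
  · intro L hL r
    -- the rotation acts on column `r` only
    refine ⟨_, measurePreserving_vecAct
      (M := Matrix.blockDiagonal fun a : Fin k => if a = r then L else 1)
      (hΓ.posDef β hβ) hS' ?_, fun Y => ⟨?_, fun s hs => ?_⟩⟩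
    · obtain ⟨σ, hσ, rfl⟩ := hS
      rw [Matrix.kronecker_diagonal, Matrix.blockDiagonal_transpose, ← Matrix.blockDiagonal_mul,
        ← Matrix.blockDiagonal_mul]
      congr 1
      ext1 a
      split_ifs
      · simp only [op_smul_eq_smul, Matrix.mul_smul, Matrix.smul_mul, hL]
      · simp
    · ext i u
      simp [column, vecAct, Matrix.mulVec, dotProduct, Fintype.sum_prod_type,
        Matrix.blockDiagonal_apply, Matrix.mul_apply]
    · ext i u
      simp [column, vecAct, Matrix.mulVec, dotProduct, Fintype.sum_prod_type,
        Matrix.blockDiagonal_apply, hs, Matrix.one_apply]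
  · rw [V_eq]
    simp only [Fintype.card_fin, Fintype.card_unit, Nat.cast_one, one_mul]
    rcases hn.eq_or_lt with h1 | h1
    · subst h1
      rw [trace_sq_of_card_eq_one (Fintype.card_fin 1)]
      simp
    · have h2 : (n : ℝ) - 1 ≠ 0 := by
        have : (1 : ℝ) < n := by exact_mod_cast h1
        linarith
      field_simp

/-- Model I is a model with one series of length `n k` and covariance matrix `Γ ⊗ 1`. -/
theorem bartlettTwo_modelI (hn : 1 ≤ n) (hk : 1 ≤ k) (hB : IsOpen B)
    {Γ₂ : ℝ → Matrix (Fin n) (Fin n) ℝ} (hΓ : IsSmoothCurve B Γ (derivMatrix Γ) Γ₂) (hβ : β ∈ B)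
    (hS : S ∈ modelI k) :
    BartlettTwo (modelI k) B Γ β S (V Γ β * ((k : ℝ) ^ 2 / (2 * ((n : ℝ) * k + 2)))) := by
  have : Nonempty (Fin n × Fin k) := ⟨(⟨0, hn⟩, ⟨0, hk⟩)⟩
  have hS' := posDef_of_mem_modelI hS
  have hinj : ∀ᵐ Y ∂(law (Γ β) S), Function.Injective (vectorize Y).mulVec := by
    filter_upwards [ae_det_submatrix_ne_zero (hΓ.posDef β hβ) hS' (κ := Unit)
      (e := fun _ => ⟨0, hn⟩) (f := fun _ => ⟨0, hk⟩) (Function.injective_of_subsingleton _)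
      (Function.injective_of_subsingleton _)] with Y hY
    exact injective_mulVec_of_det_submatrix_ne_zero (e := fun _ => (⟨0, hn⟩, ⟨0, hk⟩)) hY
  refine bartlettTwo_of_concentrated hB hβ (hΓ.kronecker_one (k := k))
    (fun (_ : Unit) Y => vectorize Y)
    (fun _ p _ => measurable_entry p.1 p.2) (hinj.mono fun Y hY _ => hY)
    (n * k / 2 * Real.log (n * k) - n * k / 2) ?_ ?_ ?_
  · filter_upwards [hinj] with Y hY b hb
    rw [profileLogLik_modelI_eq hn hk (hΓ.posDef b hb) hY, Fintype.sum_unique]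
  · intro L hL r
    refine ⟨_, measurePreserving_vecAct (M := L) (hΓ.posDef β hβ) hS' ?_,
      fun Y => ⟨rfl, fun s hs => (hs rfl).elim⟩⟩
    obtain ⟨σ, hσ, rfl⟩ := hS
    rw [Matrix.kronecker_smul, Matrix.mul_smul, Matrix.smul_mul, hL]
  · have e : ∀ A C : Matrix (Fin n) (Fin n) ℝ,
        A ⊗ₖ (1 : Matrix (Fin k) (Fin k) ℝ) * C ⊗ₖ (1 : Matrix (Fin k) (Fin k) ℝ) =
        (A * C) ⊗ₖ (1 : Matrix (Fin k) (Fin k) ℝ) := fun A C => by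
      rw [← Matrix.mul_kronecker_mul, Matrix.one_mul]
    rw [V_eq, Matrix.inv_kronecker, inv_one]
    simp only [e, Matrix.trace_kronecker, Matrix.trace_one, Fintype.card_fin, Fintype.card_prod,
      Fintype.card_unit, Nat.cast_one, one_mul, Nat.cast_mul]
    have hn0 : (1 : ℝ) ≤ n := by exact_mod_cast hn
    have hk0 : (1 : ℝ) ≤ k := by exact_mod_cast hk
    by_cases h1 : n * k = 1
    · obtain rfl : n = 1 := Nat.dvd_one.1 (Dvd.intro _ h1)
      obtain rfl : k = 1 := Nat.dvd_one.1 (Dvd.intro_left _ h1)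
      rw [trace_sq_of_card_eq_one (Fintype.card_fin 1)]
      simp
    · have h2 : (n : ℝ) * k - 1 ≠ 0 := by
        intro h
        apply h1
        exact_mod_cast sub_eq_zero.1 h
      have h3 : (n : ℝ) * k + 2 ≠ 0 := by positivity
      field_simp

end Models

/-! ### At least as many series as observations -/

section ManySeries

variable {n k : ℕ}

/-- If the columns of `Y` are linearly dependent, the likelihood is unbounded: the precision matrix
`1 + t v vᵀ` with `Y v = 0` has the same quadratic form for all `t`. -/
theorem profileLogLik_modelIII_eq_top (hn : 1 ≤ n) {G : Matrix (Fin n) (Fin n) ℝ} (hG : G.PosDef)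
    {Y : Matrix (Fin n) (Fin k) ℝ} {v : Fin k → ℝ} (hv : v ≠ 0) (hYv : Y *ᵥ v = 0) :
    profileLogLik (modelIII k) G Y = ⊤ := by
  rw [EReal.eq_top_iff_forall_lt]
  intro c
  have hn1 : (1 : ℝ) ≤ n := by exact_mod_cast hn
  have hq : 0 < v ⬝ᵥ v := by
    have := Matrix.dotProduct_star_self_pos_iff.2 hv
    rwa [star_trivial] at this
  set C : ℝ := c + 1 / 2 * (k * Real.log G.det) + 1 / 2 * (Yᵀ * G⁻¹ * Y).trace with hC
  set x : ℝ := 2 * |C| + 1 with hx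
  set t : ℝ := (Real.exp x - 1) / (v ⬝ᵥ v) with ht
  have ht0 : 0 ≤ t := div_nonneg (by
    have := Real.add_one_le_exp x
    have := abs_nonneg C
    linarith) hq.le
  have hR : (1 + t • Matrix.vecMulVec v v).PosDef := by
    refine Matrix.PosDef.one.add_posSemidef (Matrix.PosSemidef.smul ?_ ht0)
    have := Matrix.posSemidef_vecMulVec_self_star v
    rwa [star_trivial] at this
  have hdet : (1 + t • Matrix.vecMulVec v v).det = Real.exp x := by
    rw [← Matrix.smul_vecMulVec, Matrix.vecMulVec_eq Unit,
      Matrix.det_one_add_replicateCol_mul_replicateRow, dotProduct_smul, smul_eq_mul, ht,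
      div_mul_cancel₀ _ hq.ne']
    ring
  have hS : (1 + t • Matrix.vecMulVec v v)⁻¹ ∈ modelIII k := hR.inv
  refine lt_of_lt_of_le ?_ (le_iSup₂_of_le _ hS le_rfl)
  rw [EReal.coe_lt_coe_iff, logLik, log_det_kronecker hG hR.inv,
    Matrix.nonsing_inv_nonsing_inv _ (isUnit_iff_ne_zero.2 hR.det_pos.ne'), Matrix.det_nonsing_inv,
    Ring.inverse_eq_inv', Real.log_inv, hdet, Real.log_exp]
  have htr : (Yᵀ * G⁻¹ * Y * (1 + t • Matrix.vecMulVec v v)).trace = (Yᵀ * G⁻¹ * Y).trace := by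
    rw [Matrix.mul_add, Matrix.mul_one, Matrix.mul_smul, Matrix.mul_vecMulVec,
      ← Matrix.mulVec_mulVec, hYv, Matrix.mulVec_zero]
    simp
  rw [htr]
  have h1 : x ≤ n * x := le_mul_of_one_le_left (by positivity) hn1
  have h2 := le_abs_self C
  linarith

theorem exists_profileLogLik_modelIII_eq (hn : 1 ≤ n) (hk : n ≤ k)
    (Y : Matrix (Fin n) (Fin k) ℝ) :
    ∃ c : EReal, ∀ G : Matrix (Fin n) (Fin n) ℝ, G.PosDef →
      profileLogLik (modelIII k) G Y = c := by
  by_cases hY : Function.Injective Y.mulVec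
  · -- for square `Y` the two occurrences of `log det G` cancel
    have hkn : k = n := by
      refine le_antisymm ?_ hk
      have := LinearMap.finrank_le_finrank_of_injective (f := Y.mulVecLin) hY
      simpa using this
    subst hkn
    have hdet : Y.det ≠ 0 := isUnit_iff_ne_zero.1
      ((Matrix.isUnit_iff_isUnit_det _).1 (Matrix.mulVec_injective_iff_isUnit.1 hY))
    refine ⟨_, fun G hG => (profileLogLik_modelIII_eq hn hG hY).trans
      (congrArg (fun z : ℝ => ((k * k / 2 * Real.log k - k * k / 2 + z : ℝ) : EReal))
        (?_ : _ = -(k / 2 * Real.log (Y.det * Y.det))))⟩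
    rw [concentrated, Matrix.det_mul, Matrix.det_mul, Matrix.det_transpose,
      Matrix.det_nonsing_inv, Ring.inverse_eq_inv', mul_right_comm,
      Real.log_mul (mul_ne_zero hdet hdet) (inv_ne_zero hG.det_pos.ne'), Real.log_inv,
      Fintype.card_fin]
    ring
  · rw [← Matrix.coe_mulVecLin, ← LinearMap.ker_eq_bot] at hY
    obtain ⟨v, hv, hv0⟩ := (Submodule.ne_bot_iff _).1 hY
    exact ⟨⊤, fun G hG => profileLogLik_modelIII_eq_top hn hG hv0 hv⟩

/-- `Y' W Y` and `W Y Y'` have the same non-zero eigenvalues. -/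
theorem pseudoDet_eq_det {W : Matrix (Fin n) (Fin n) ℝ} (hW : W.PosDef)
    {Y : Matrix (Fin n) (Fin k) ℝ} (hY : (Y * Yᵀ).det ≠ 0) :
    pseudoDet (Yᵀ * W * Y) = W.det * (Y * Yᵀ).det := by
  obtain ⟨K, hK, -⟩ := exists_inv_eq_transpose_mul_self hW.inv
  rw [Matrix.nonsing_inv_nonsing_inv _ (isUnit_iff_ne_zero.2 hW.det_pos.ne')] at hK
  have hsplit : (W * (Y * Yᵀ)).charpoly.Splits := by
    rw [hK, Matrix.mul_assoc, Matrix.charpoly_mul_comm]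
    refine Matrix.IsHermitian.splits_charpoly ?_
    rw [Matrix.IsHermitian, Matrix.conjTranspose_eq_transpose_of_trivial]
    simp only [Matrix.transpose_mul, Matrix.transpose_transpose, Matrix.mul_assoc]
  have hdet : (W * (Y * Yᵀ)).det = W.det * (Y * Yᵀ).det := Matrix.det_mul _ _
  have hne : (W * (Y * Yᵀ)).det ≠ 0 := by
    rw [hdet]
    exact mul_ne_zero hW.det_pos.ne' hY
  rw [← hdet, Matrix.det_eq_prod_roots_charpoly_of_splits hsplit, pseudoDet]
  congr 1
  have h1 := Matrix.charpoly_mul_comm' Yᵀ (W * Y)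
  -- the two characteristic polynomials differ by a power of the variable, so only by zero roots
  have h2 := congrArg (fun p : Polynomial ℝ => p.roots.filter fun x => x ≠ 0) h1
  have hX : ∀ (m : ℕ), (Polynomial.X ^ m : Polynomial ℝ) ≠ 0 := fun m =>
    pow_ne_zero _ Polynomial.X_ne_zero
  have h0 : ∀ m : ℕ, ((m • ({0} : Multiset ℝ)).filter fun x => x ≠ 0) = 0 := fun m =>
    Multiset.filter_eq_nil.2 fun a ha => by
      rw [not_not]
      exact Multiset.mem_singleton.1 (Multiset.mem_of_mem_nsmul ha)
  rw [Polynomial.roots_mul (mul_ne_zero (hX _) (Matrix.charpoly_monic _).ne_zero),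
    Polynomial.roots_mul (mul_ne_zero (hX _) (Matrix.charpoly_monic _).ne_zero),
    Polynomial.roots_X_pow, Polynomial.roots_X_pow, Multiset.filter_add, Multiset.filter_add,
    h0, h0, zero_add, zero_add, ← Matrix.mul_assoc, Matrix.mul_assoc W] at h2
  rw [h2]
  refine Multiset.filter_eq_self.2 fun x hx hx0 => hne ?_
  rw [Matrix.det_eq_prod_roots_charpoly_of_splits hsplit]
  exact Multiset.prod_eq_zero (hx0 ▸ hx)

theorem ae_det_mul_transpose_ne_zero (hk : n ≤ k) {Γ : Matrix (Fin n) (Fin n) ℝ}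
    {S : Matrix (Fin k) (Fin k) ℝ} (hΓ : Γ.PosDef) (hS : S.PosDef) :
    ∀ᵐ Y ∂(law Γ S), (Y * Yᵀ).det ≠ 0 := by
  filter_upwards [ae_det_submatrix_ne_zero hΓ hS Function.injective_id
    (Fin.castLE_injective hk)] with Y hY
  have h1 : (Yᵀ.submatrix (Fin.castLE hk) id).det ≠ 0 := by
    rwa [← Matrix.transpose_submatrix, Matrix.det_transpose]
  have h2 := Matrix.PosDef.conjTranspose_mul_self _ (injective_mulVec_of_det_submatrix_ne_zero h1)
  rw [Matrix.conjTranspose_eq_transpose_of_trivial, Matrix.transpose_transpose] at h2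
  exact h2.det_pos.ne'

theorem marginalLogLik_eq (hk : n ≤ k) {G : Matrix (Fin n) (Fin n) ℝ} (hG : G.PosDef)
    {Y : Matrix (Fin n) (Fin k) ℝ} (hY : (Y * Yᵀ).det ≠ 0) :
    marginalLogLik G Y = -(k / 2 * Real.log (Y * Yᵀ).det) := by
  rw [marginalLogLik, pseudoDet_eq_det hG.inv hY, max_eq_left hk,
    Real.log_mul hG.inv.det_pos.ne' hY]
  ring

/-- The orbit of the partial identity matrix contains every matrix whose leading `n × n` block is
invertible: the remaining rows of the group element are those of the identity matrix. -/
theorem exists_orbit (hk : n ≤ k) :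
    ∃ Y₀ : Matrix (Fin n) (Fin k) ℝ, ∀ Y : Matrix (Fin n) (Fin k) ℝ,
      (Y.submatrix id (Fin.castLE hk)).det ≠ 0 →
      ∃ g : GL (Fin k) ℝ, Y = Y₀ * (g : Matrix (Fin k) (Fin k) ℝ) := by
  obtain ⟨m, rfl⟩ := Nat.exists_eq_add_of_le hk
  refine ⟨Matrix.of fun i r => if r = Fin.castAdd m i then 1 else 0, fun Y hY => ?_⟩
  let g : Matrix (Fin (n + m)) (Fin (n + m)) ℝ := Matrix.of fun r s =>
    Fin.addCases (fun i => Y i s) (fun j => if s = Fin.natAdd n j then 1 else 0) r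
  have hg : g.submatrix finSumFinEquiv finSumFinEquiv =
      Matrix.fromBlocks (Y.submatrix id (Fin.castLE hk)) (Y.submatrix id (Fin.natAdd n)) 0 1 := by
    ext r s
    rcases r with i | i <;> rcases s with j | j
    · simp [g]; rfl
    · simp [g]
    · simp [g, Fin.ext_iff]; omega
    · simp [g, Matrix.one_apply, eq_comm]
  have hdet : g.det ≠ 0 := by
    rw [← Matrix.det_submatrix_equiv_self finSumFinEquiv, hg, Matrix.det_fromBlocks_zero₂₁,
      Matrix.det_one, mul_one]
    exact hY
  refine ⟨Matrix.GeneralLinearGroup.mkOfDetNeZero g hdet, ?_⟩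
  ext i s
  simp [Matrix.mul_apply, Matrix.GeneralLinearGroup.mkOfDetNeZero, g]

end ManySeries

/-! ### Comparison of the numbers of series -/

section Comparison

variable {n : ℕ} {B : Set ℝ} {Γ Γ₂ : ℝ → Matrix (Fin n) (Fin n) ℝ} {β : ℝ}

theorem V_eq_zero_of_one {Γ : ℝ → Matrix (Fin 1) (Fin 1) ℝ} : V Γ β = 0 := by
  rw [V_eq, trace_sq_of_card_eq_one (Fintype.card_fin 1)]
  simp

/-- `V` is non-negative, as it is proportional to a variance. -/
theorem V_nonneg (hn : 1 ≤ n) (hB : IsOpen B) (hΓ : IsSmoothCurve B Γ (derivMatrix Γ) Γ₂)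
    (hβ : β ∈ B) : 0 ≤ V Γ β := by
  have h := (bartlettTwo_modelII (k := 1) hn hB hΓ hβ
    (S := Matrix.diagonal fun _ => (1 : ℝ) ^ 2)
    ⟨fun _ => 1, fun _ => one_pos, rfl⟩).fisherInfo_eq
  have h1 : 0 ≤ V Γ β * (((1 : ℕ) : ℝ) / (2 * ((n : ℝ) + 2))) := by
    rw [← h]
    exact variance_nonneg _ _
  exact nonneg_of_mul_nonneg_left h1 (by positivity)

/-- `k (n - k) = n² / 4 - (k - n / 2)²` is larger the closer `k` is to `n / 2`. -/
theorem mul_sub_sub_mul_sub (n k l : ℝ) :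
    k * (n - k) - l * (n - l) = |l - n / 2| ^ 2 - |k - n / 2| ^ 2 := by
  rw [sq_abs, sq_abs]
  ring

theorem fisherInfo_modelIII_compare (hn : 1 ≤ n) (hB : IsOpen B)
    (hΓ : IsSmoothCurve B Γ (derivMatrix Γ) Γ₂) (hβ : β ∈ B) {k l : ℕ} (hk : k ≤ n) (hl : l ≤ n)
    {S : Matrix (Fin k) (Fin k) ℝ} (hS : S ∈ modelIII k) {T : Matrix (Fin l) (Fin l) ℝ}
    (hT : T ∈ modelIII l) :
    fisherInfo (modelIII k) Γ β S - fisherInfo (modelIII l) Γ β T =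
      V Γ β * ((|(l : ℝ) - n / 2| ^ 2 - |(k : ℝ) - n / 2| ^ 2) /
        (2 * ((n : ℝ) - 1) * ((n : ℝ) + 2))) := by
  rw [(bartlettTwo_modelIII hn hk hB hΓ hβ hS).fisherInfo_eq,
    (bartlettTwo_modelIII hn hl hB hΓ hβ hT).fisherInfo_eq, ← mul_sub_sub_mul_sub]
  ring

end Comparison

end SeparableGaussian

theorem mainTheorem1 {n : ℕ} (hn : 1 ≤ n)
    (B : Set ℝ) (hB : IsOpen B)
    (Γ : ℝ → Matrix (Fin n) (Fin n) ℝ)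
    (hpos : ∀ b ∈ B, (Γ b).PosDef)
    (hdiff : ∀ i j, DifferentiableOn ℝ (fun b => Γ b i j) B)
    (hdiff2 : ∀ i j, DifferentiableOn ℝ (deriv fun b => Γ b i j) B)
    (β : ℝ) (hβ : β ∈ B) :
    -- Model I
    (∀ k : ℕ, 1 ≤ k → ∀ S ∈ SeparableGaussian.modelI k,
      SeparableGaussian.BartlettTwo (SeparableGaussian.modelI k) B Γ β S
        (SeparableGaussian.V Γ β * ((k : ℝ) ^ 2 / (2 * ((n : ℝ) * k + 2))))) ∧
    -- Model II
    (∀ k : ℕ, 1 ≤ k → ∀ S ∈ SeparableGaussian.modelII k,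
      SeparableGaussian.BartlettTwo (SeparableGaussian.modelII k) B Γ β S
        (SeparableGaussian.V Γ β * ((k : ℝ) / (2 * ((n : ℝ) + 2))))) ∧
    -- Model III
    (2 ≤ n → ∀ k : ℕ, 1 ≤ k → k ≤ n → ∀ S ∈ SeparableGaussian.modelIII k,
      SeparableGaussian.BartlettTwo (SeparableGaussian.modelIII k) B Γ β S
        (SeparableGaussian.V Γ β *
          ((k : ℝ) * ((n : ℝ) - k) / (2 * ((n : ℝ) - 1) * ((n : ℝ) + 2))))) ∧
    -- Model III: the closer `k` is to `n / 2`, the larger the Fisher information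
    (∀ k l : ℕ, 1 ≤ k → k ≤ n → 1 ≤ l → l ≤ n →
      ∀ S ∈ SeparableGaussian.modelIII k, ∀ T ∈ SeparableGaussian.modelIII l,
      (|(k : ℝ) - n / 2| ≤ |(l : ℝ) - n / 2| →
        SeparableGaussian.fisherInfo (SeparableGaussian.modelIII l) Γ β T ≤
          SeparableGaussian.fisherInfo (SeparableGaussian.modelIII k) Γ β S) ∧
      (SeparableGaussian.V Γ β ≠ 0 → |(k : ℝ) - n / 2| < |(l : ℝ) - n / 2| →
        SeparableGaussian.fisherInfo (SeparableGaussian.modelIII l) Γ β T <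
          SeparableGaussian.fisherInfo (SeparableGaussian.modelIII k) Γ β S)) ∧
    -- Model III: the Fisher information vanishes at `k = n`
    (∀ S ∈ SeparableGaussian.modelIII n,
      SeparableGaussian.BartlettTwo (SeparableGaussian.modelIII n) B Γ β S 0) ∧
    -- Model III: for `k ≥ n` the profile likelihood and the marginal likelihood are constant, and
    -- a single orbit of the group `GL_k` has probability one
    (∀ k : ℕ, n ≤ k →
      (∀ Y : Matrix (Fin n) (Fin k) ℝ, ∃ c : EReal, ∀ G : Matrix (Fin n) (Fin n) ℝ, G.PosDef →
        SeparableGaussian.profileLogLik (SeparableGaussian.modelIII k) G Y = c) ∧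
      (∀ G₀ : Matrix (Fin n) (Fin n) ℝ, G₀.PosDef → ∀ S ∈ SeparableGaussian.modelIII k,
        ∀ᵐ Y ∂(SeparableGaussian.law G₀ S), ∃ c : ℝ,
          ∀ G : Matrix (Fin n) (Fin n) ℝ, G.PosDef →
            SeparableGaussian.marginalLogLik G Y = c) ∧
      (∃ Y₀ : Matrix (Fin n) (Fin k) ℝ, ∀ G : Matrix (Fin n) (Fin n) ℝ, G.PosDef →
        ∀ S ∈ SeparableGaussian.modelIII k,
          ∀ᵐ Y ∂(SeparableGaussian.law G S), ∃ g : GL (Fin k) ℝ,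
            Y = Y₀ * (g : Matrix (Fin k) (Fin k) ℝ))) := by
  have hΓ := SeparableGaussian.isSmoothCurve_of_differentiableOn hB hpos hdiff hdiff2
  have hVnn := SeparableGaussian.V_nonneg hn hB hΓ hβ
  have hn1 : (1 : ℝ) ≤ n := by exact_mod_cast hn
  have hden : (0 : ℝ) ≤ 2 * ((n : ℝ) - 1) * ((n : ℝ) + 2) :=
    mul_nonneg (by linarith) (by linarith)
  refine ⟨fun k hk S hS => SeparableGaussian.bartlettTwo_modelI hn hk hB hΓ hβ hS,
    fun k _ S hS => SeparableGaussian.bartlettTwo_modelII hn hB hΓ hβ hS,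
    fun _ k _ hkn S hS => SeparableGaussian.bartlettTwo_modelIII hn hkn hB hΓ hβ hS,
    fun k l hk hkn hl hln S hS T hT => ?_, fun S hS => ?_, fun k hk => ⟨?_, ?_, ?_⟩⟩
  · have hcmp := SeparableGaussian.fisherInfo_modelIII_compare hn hB hΓ hβ hkn hln hS hT
    refine ⟨fun h => ?_, fun hV h => ?_⟩
    · have h1 := pow_le_pow_left₀ (abs_nonneg _) h 2
      have := mul_nonneg hVnn (div_nonneg (sub_nonneg.2 h1) hden)
      linarith
    · have h1 := pow_lt_pow_left₀ h (abs_nonneg _) two_ne_zero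
      -- `V` vanishes for `n = 1`
      have hn2 : (1 : ℝ) < n := by
        refine lt_of_le_of_ne hn1 fun h0 => hV ?_
        obtain rfl : n = 1 := by exact_mod_cast h0.symm
        exact SeparableGaussian.V_eq_zero_of_one
      have hden' : (0 : ℝ) < 2 * ((n : ℝ) - 1) * ((n : ℝ) + 2) :=
        mul_pos (by linarith) (by linarith)
      have := mul_pos (hVnn.lt_of_ne hV.symm) (div_pos (sub_pos.2 h1) hden')
      linarith
  · have := SeparableGaussian.bartlettTwo_modelIII hn le_rfl hB hΓ hβ hS
    rwa [sub_self, mul_zero, zero_div, mul_zero] at this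
  · exact SeparableGaussian.exists_profileLogLik_modelIII_eq hn hk
  · intro G₀ hG₀ S hS
    filter_upwards [SeparableGaussian.ae_det_mul_transpose_ne_zero hk hG₀ hS] with Y hY
    exact ⟨_, fun G hG => SeparableGaussian.marginalLogLik_eq hk hG hY⟩
  · obtain ⟨Y₀, hY₀⟩ := SeparableGaussian.exists_orbit hk
    refine ⟨Y₀, fun G hG S hS => ?_⟩
    filter_upwards [SeparableGaussian.ae_det_submatrix_ne_zero hG hS Function.injective_id
      (Fin.castLE_injective hk)] with Y hY
    exact hY₀ Y hY
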